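/- **Setting.** A *local Moufang set* $\mathbb M$ consists of a set with equivalence relation $(X,\sim)$ having more than two classes and, for each $x\in X$, a group $U_x$ of $\sim$-preserving permutations of $X$ (acting on the right), such that, with $G=\langle U_x\mid x\in X\rangle$, $[x]$ the class of $x$ and $\overline{U_x}$ the group induced by $U_x$ on the set $\overline X$ of classes: $\overline{U_x}=\overline{U_y}$ whenever $x\sim y$; $U_x$ fixes $x$ and acts sharply transitively on $X\setminus[x]$; $\overline{U_x}$ fixes $[x]$ and acts sharply transitively on $\overline X\setminus\{[x]\}$; and $g^{-1}U_xg=U_{xg}$ for all $x\in X$, $g\in G$. Fix $0,\infty\in X$ with $0\nsim\infty$. A *unit* is an $x\in X$ with $x\nsim0$ and $x\nsim\infty$. For $x\nsim\infty$ let $\alpha_x$ be the unique element of $U_\infty$ with $0\alpha_x=x$, and put $-x=0\alpha_x^{-1}$ and $x\cdot k=0\alpha_x^k$ for $k\ge1$. For a unit $x$ let $\mu_x$ be the unique element of $U_0\alpha_xU_0$ that interchanges $0$ and $\infty$. Fix a unit $e$ and let $\tau=\mu_e$. Assume: * (J1) $\mathbb M$ is special: $(-(x\tau^{-1}))\tau=-x$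 for all units $x$; * (J2) $U_\infty$ is abelian (hence so is $U_0$); * (J3) if $x$ is a unit, then so are $x\cdot2$ and $x\cdot3$. Let $V^+=X\setminus[\infty]$, an abelian group under $x+z=0\alpha_x\alpha_z$, and $V^-=X\setminus[0]$, an abelian group under $y\mathbin{\tilde+}w=\infty\beta_y\beta_w$, where $\beta_y$ is the unique element of $U_0$ with $\infty\beta_y=y$. Every $\mu_t$ maps $V^+$ to $V^-$ and $V^-$ to $V^+$. Assume moreover: * (J4) there are biadditive maps $\mu_{\cdot,\cdot}\colon V^+\times V^+\to\operatorname{Hom}(V^-,V^+)$ and $\tilde\mu_{\cdot,\cdot}\colon V^-\times V^-\to\operatorname{Hom}(V^+,V^-)$ such that $\mu_{x,z}=\mu_{x+z}-\mu_x-\mu_z$ whenever $x$, $z$ and $x+z$ are units, and $\tilde\mu_{y,w}=\mu_{y\tilde+w}\mathbin{\tilde-}\mu_y\mathbin{\tilde-}\mu_w$ whenever $y$, $w$ and $y\mathbin{\tilde+}w$ are units. **Jordan pairs.** Let $V=(V^+,V^-)$ be a pair of $k$-modules with quadratic maps $Q\colon V^\sigma\to\operatorname{Hom}(V^{-\sigma},V^\sigma)$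 ($\sigma=\pm$), and write $\{xyz\}=yQ_{x,z}=y(Q_{x+z}-Q_x-Q_z)$. Then $V$ is a *Jordan pair* over $k$ if, for both signs and in all scalar extensions of $k$, $\{x\,y\,zQ_x\}=\{y\,x\,z\}Q_x$, $\{yQ_x\,y\,z\}=\{x\,xQ_y\,z\}$ and $Q_{yQ_x}=Q_xQ_yQ_x$. An element $x$ is *invertible* if $Q_x$ is. An *ideal* is a pair of submodules $(I^+,I^-)$ with $xQ_y\in I^{-\sigma}$, $yQ_x\in I^\sigma$ and $\{xyz\}\in I^\sigma$ for $x\in I^\sigma$, $y\in V^{-\sigma}$, $z\in V^\sigma$. A Jordan pair is *local* if its non-invertible elements form a proper ideal. For $x\in V^+$ and $y\in V^-$, $(x,y)$ is *quasi-invertible* if $z\mapsto z-\{xyz\}+zQ_yQ_x$ is an invertible map on $V^+$; $\operatorname{Rad}V=(\operatorname{Rad}V^+,\operatorname{Rad}V^-)$ consists of the $x\in V^+$ such that $(x,y)$ is quasi-invertible for all $y\in V^-$, and the $y\in V^-$ such that $(x,y)$ is quasi-invertible for all $x\in V^+$. **Theorem.** Under (J1)–(J4), $V^+$ is uniquely $2$-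 and $3$-divisible, $V^-$ is uniquely $2$-divisible, and $V=(V^+,V^-)$ with $$Q_x=\tfrac12\,\mu_{x,x}\ (x\in V^+),\qquad Q_y=\tfrac12\,\tilde\mu_{y,y}\ (y\in V^-)$$ is a Jordan pair over $\mathbb Z$. Its non-invertible elements form the proper ideal $([0],[\infty])$, so $V$ is a local Jordan pair, and $\operatorname{Rad}V=([0],[\infty])$. -/

import Mathlib

open scoped TensorProduct

universe t u v w

/-! ## Local Moufang sets

Permutations are written as functions, so the right-action product `g h` ("first `g`, then `h`") is
`h * g` here, the image `x g` is `g • x`, and the conjugate `u ^ g = g⁻¹ u g` is `g * u * g⁻¹`. -/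

/-- The group `Sym(X, ∼)` of equivalence-preserving bijections of `X`. -/
def SymRel {X : Type u} (r : Setoid X) : Subgroup (Equiv.Perm X) where
  carrier := {g | ∀ x y, r x y ↔ r (g x) (g y)}
  mul_mem' := by
    intro a b ha hb x y
    exact (hb x y).trans (ha (b x) (b y))
  one_mem' := fun _ _ => Iff.rfl
  inv_mem' := by
    intro a ha x y
    simpa using (ha (a⁻¹ x) (a⁻¹ y)).symm

/-- The permutation of the set of classes induced by an element of `Sym(X, ∼)`. -/
def SymRel.induced {X : Type u} (r : Setoid X) : SymRel r →* Equiv.Perm (Quotient r) where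
  toFun g := Quotient.congr (g : Equiv.Perm X) g.2
  map_one' := by
    ext q
    induction q using Quotient.inductionOn
    rfl
  map_mul' a b := by
    ext q
    induction q using Quotient.inductionOn
    rfl

theorem SymRel.rel_smul {X : Type u} {r : Setoid X} (g : SymRel r) (x y : X) :
    r (g • x) (g • y) ↔ r x y := (g.2 x y).symm

/-- A local Moufang set acting on `X`: an equivalence relation with more than two classes and a
root group `U x` for each point `x`. Sharp transitivity is required of the action of `U x` on
`X ∖ [x]` and of the induced group on the set of classes other than `[x]`. -/
structure LocalMoufangSet (X : Type u) where
  /-- the equivalence relation `∼` -/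
  rel : Setoid X
  two_lt_card : 2 < Cardinal.mk (Quotient rel)
  /-- the root groups -/
  U : X → Subgroup (SymRel rel)
  induced_eq : ∀ x y, rel x y →
    (U x).map (SymRel.induced rel) = (U y).map (SymRel.induced rel)
  fixes : ∀ x, ∀ g ∈ U x, g • x = x
  sharplyTransitive : ∀ x y z, ¬ rel y x → ¬ rel z x → ∃! g, g ∈ U x ∧ g • y = z
  induced_fixes : ∀ x, ∀ g ∈ (U x).map (SymRel.induced rel),
    g • (Quotient.mk rel x) = Quotient.mk rel x
  induced_sharplyTransitive : ∀ x, ∀ y z : Quotient rel,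
    y ≠ Quotient.mk rel x → z ≠ Quotient.mk rel x →
      ∃! g, g ∈ (U x).map (SymRel.induced rel) ∧ g • y = z
  /-- `U_x ^ g = U_{x g}` for all `g` in the little projective group -/
  conj_eq : ∀ x, ∀ g ∈ (⨆ y, U y : Subgroup (SymRel rel)),
    (U x).map (MulAut.conj g).toMonoidHom = U (g • x)

namespace LocalMoufangSet

variable {X : Type u}

/-- A basis: a pair of non-equivalent points `(0, ∞)`. -/
structure Basis (M : LocalMoufangSet X) where
  zero : X
  inf : X
  not_rel : ¬ M.rel zero inf

namespace Basis

variable {M : LocalMoufangSet X}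

/-- The basis `(∞, 0)`. -/
def swap (B : M.Basis) : M.Basis := ⟨B.inf, B.zero, fun h => B.not_rel (M.rel.symm h)⟩

/-- `x` is a unit if `x ≁ 0` and `x ≁ ∞`. -/
def IsUnit (B : M.Basis) (x : X) : Prop := ¬ M.rel x B.zero ∧ ¬ M.rel x B.inf

/-- The set `X ∖ [∞]`. For the basis `B.swap` this is `X ∖ [0]`. -/
def Aff (B : M.Basis) : Type u := {x : X // ¬ M.rel x B.inf}

/-- `α_x`, the unique element of `U_∞` mapping `0` to `x`. For the basis `B.swap` this is the unique
element of `U_0` mapping `∞` to `x`. -/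
noncomputable def alpha (B : M.Basis) (x : B.Aff) : SymRel M.rel :=
  (M.sharplyTransitive B.inf B.zero x.1 B.not_rel x.2).choose

theorem alpha_mem (B : M.Basis) (x : B.Aff) : B.alpha x ∈ M.U B.inf :=
  (M.sharplyTransitive B.inf B.zero x.1 B.not_rel x.2).choose_spec.1.1

theorem alpha_smul (B : M.Basis) (x : B.Aff) : B.alpha x • B.zero = x.1 :=
  (M.sharplyTransitive B.inf B.zero x.1 B.not_rel x.2).choose_spec.1.2

theorem alpha_unique (B : M.Basis) (x : B.Aff) (g : SymRel M.rel) (hg : g ∈ M.U B.inf)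
    (h : g • B.zero = x.1) : g = B.alpha x :=
  (M.sharplyTransitive B.inf B.zero x.1 B.not_rel x.2).choose_spec.2 g ⟨hg, h⟩

theorem smul_not_rel (B : M.Basis) (g : SymRel M.rel) (hg : g ∈ M.U B.inf) (x : X)
    (hx : ¬ M.rel x B.inf) : ¬ M.rel (g • x) B.inf := by
  rw [← M.fixes B.inf g hg]
  rwa [SymRel.rel_smul]

/-- The point `0 g` of `X ∖ [∞]`, for `g ∈ U_∞`. -/
def orbitPt (B : M.Basis) (g : SymRel M.rel) (hg : g ∈ M.U B.inf) : B.Aff :=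
  ⟨g • B.zero, B.smul_not_rel g hg B.zero B.not_rel⟩

theorem alpha_orbitPt (B : M.Basis) (g : SymRel M.rel) (hg : g ∈ M.U B.inf) :
    B.alpha (B.orbitPt g hg) = g :=
  (B.alpha_unique _ g hg rfl).symm

theorem orbitPt_alpha (B : M.Basis) (x : B.Aff) :
    B.orbitPt (B.alpha x) (B.alpha_mem x) = x := Subtype.ext (B.alpha_smul x)

theorem alpha_injective (B : M.Basis) : Function.Injective B.alpha := by
  intro x y h
  apply Subtype.ext
  rw [← B.alpha_smul x, ← B.alpha_smul y, h]

/-- `-x = 0 α_x⁻¹`. -/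
noncomputable def neg (B : M.Basis) (x : B.Aff) : B.Aff :=
  B.orbitPt (B.alpha x)⁻¹ (inv_mem (B.alpha_mem x))

/-- `x + z = 0 α_x α_z`. -/
noncomputable def add (B : M.Basis) (x z : B.Aff) : B.Aff :=
  B.orbitPt (B.alpha z * B.alpha x) (mul_mem (B.alpha_mem z) (B.alpha_mem x))

/-- `x · k = 0 α_x ^ k`. -/
noncomputable def times (B : M.Basis) (x : B.Aff) (k : ℕ) : B.Aff :=
  B.orbitPt (B.alpha x ^ k) (pow_mem (B.alpha_mem x) k)

theorem neg_not_rel (B : M.Basis) (x : B.Aff) (hx : ¬ M.rel x.1 B.zero) :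
    ¬ M.rel (B.neg x).1 B.zero := by
  intro h
  apply hx
  have h1 := (SymRel.rel_smul (B.alpha x) _ _).2 h
  have h2 : B.alpha x • (B.neg x).1 = B.zero := by
    change B.alpha x • ((B.alpha x)⁻¹ • B.zero) = B.zero
    rw [smul_inv_smul]
  rw [h2, B.alpha_smul] at h1
  exact M.rel.symm h1

/-- The element `α_x` for a unit `x`. -/
noncomputable def alphaUnit (B : M.Basis) (x : X) (hx : B.IsUnit x) : SymRel M.rel :=
  B.alpha ⟨x, hx.2⟩

/-- For each unit `x` there is a unique element of `U_0 α_x U_0` that swaps `0` and `∞`. -/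
theorem existsUnique_mu (B : M.Basis) (x : X) (hx : B.IsUnit x) :
    ∃! m : SymRel M.rel,
      (∃ g ∈ M.U B.zero, ∃ h ∈ M.U B.zero, m = h * B.alphaUnit x hx * g) ∧
        m • B.zero = B.inf ∧ m • B.inf = B.zero := by
  have hi : ¬ M.rel B.inf B.zero := fun h => B.not_rel (M.rel.symm h)
  have hn := B.neg_not_rel ⟨x, hx.2⟩ hx.1
  have ha : B.alphaUnit x hx • B.zero = x := B.alpha_smul ⟨x, hx.2⟩
  have hneg : B.alphaUnit x hx • (B.neg ⟨x, hx.2⟩).1 = B.zero := by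
    change B.alpha _ • ((B.alpha _)⁻¹ • B.zero) = B.zero
    rw [smul_inv_smul]
  obtain ⟨g, ⟨hg, hg2⟩, hgu⟩ := M.sharplyTransitive B.zero B.inf _ hi hn
  obtain ⟨h, ⟨hh, hh2⟩, hhu⟩ := M.sharplyTransitive B.zero x B.inf hx.1 hi
  refine ⟨h * B.alphaUnit x hx * g, ⟨⟨g, hg, h, hh, rfl⟩, ?_, ?_⟩, ?_⟩
  · rw [mul_smul, mul_smul, M.fixes _ g hg, ha, hh2]
  · rw [mul_smul, mul_smul, hg2, hneg, M.fixes _ h hh]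
  · rintro m ⟨⟨g', hg', h', hh', rfl⟩, h1, h2⟩
    have e1 : h' = h := by
      apply hhu
      refine ⟨hh', ?_⟩
      rwa [mul_smul, mul_smul, M.fixes _ g' hg', ha] at h1
    have e2 : g' = g := by
      apply hgu
      refine ⟨hg', ?_⟩
      have h3 : B.alphaUnit x hx • g' • B.inf = B.zero := by
        apply MulAction.injective h'
        change h' • _ = h' • _
        rw [M.fixes _ h' hh', ← mul_smul, ← mul_smul]
        exact h2
      apply MulAction.injective (B.alphaUnit x hx)
      change B.alphaUnit x hx • _ = B.alphaUnit x hx • _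
      rw [h3, hneg]
    rw [e1, e2]

/-- The `μ`-map `μ_x` of a unit `x`. -/
noncomputable def mu (B : M.Basis) (x : X) (hx : B.IsUnit x) : SymRel M.rel :=
  (B.existsUnique_mu x hx).choose

theorem mu_zero (B : M.Basis) (x : X) (hx : B.IsUnit x) : B.mu x hx • B.zero = B.inf :=
  (B.existsUnique_mu x hx).choose_spec.1.2.1

theorem mu_inf (B : M.Basis) (x : X) (hx : B.IsUnit x) : B.mu x hx • B.inf = B.zero :=
  (B.existsUnique_mu x hx).choose_spec.1.2.2

/-- `μ_t` as a map from `X ∖ [0]` to `X ∖ [∞]`. -/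
noncomputable def muPlus (B : M.Basis) (t : X) (ht : B.IsUnit t) (y : B.swap.Aff) : B.Aff :=
  ⟨B.mu t ht • y.1, fun h => y.2 (by
    rw [← B.mu_zero t ht, SymRel.rel_smul] at h
    exact h)⟩

/-- `μ_t` as a map from `X ∖ [∞]` to `X ∖ [0]`. -/
noncomputable def muMinus (B : M.Basis) (t : X) (ht : B.IsUnit t) (x : B.Aff) : B.swap.Aff :=
  ⟨B.mu t ht • x.1, fun h => x.2 (by
    change M.rel _ B.zero at h
    rw [← B.mu_inf t ht, SymRel.rel_smul] at h
    exact h)⟩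

/-- `μ_t⁻¹` as a map from `X ∖ [0]` to `X ∖ [∞]`. -/
noncomputable def muInvPlus (B : M.Basis) (t : X) (ht : B.IsUnit t) (y : B.swap.Aff) : B.Aff :=
  ⟨(B.mu t ht)⁻¹ • y.1, fun h => y.2 (by
    rw [← SymRel.rel_smul (B.mu t ht), smul_inv_smul, B.mu_inf] at h
    exact h)⟩

/-- `~x = (-(x τ⁻¹)) τ`, where `τ = μ_e`. -/
noncomputable def til (B : M.Basis) (e : X) (he : B.IsUnit e) (x : X) (hx : B.IsUnit x) : X :=
  (B.muMinus e he (B.neg (B.muInvPlus e he ⟨x, hx.1⟩))).1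

/-- `M` is special (with respect to the basis `(0, ∞)` and `τ = μ_e`): `~x = -x` for all units. -/
def IsSpecial (B : M.Basis) (e : X) (he : B.IsUnit e) : Prop :=
  ∀ (x : X) (hx : B.IsUnit x), B.til e he x hx = (B.neg ⟨x, hx.2⟩).1

/-- The root group `U_∞` is abelian. -/
def IsAbelian (B : M.Basis) : Prop := ∀ g ∈ M.U B.inf, ∀ h ∈ M.U B.inf, g * h = h * g

theorem exists_unit (B : M.Basis) : ∃ c, B.IsUnit c := by
  have h3 : (3 : Cardinal) ≤ Cardinal.mk (Quotient M.rel) := by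
    have h := M.two_lt_card
    have h' := (Cardinal.natCast_add_one_le_iff (n := 2)).2 (by exact_mod_cast h)
    norm_num at h'
    exact h'
  obtain ⟨z, hz1, hz2⟩ := Cardinal.exists_ne_ne_of_three_le h3 (Quotient.mk M.rel B.zero) (Quotient.mk M.rel B.inf)
  induction z using Quotient.inductionOn with
  | h c => exact ⟨c, fun h => hz1 (Quotient.sound h), fun h => hz2 (Quotient.sound h)⟩

/-- If `U_∞` is abelian, then so is `U_0`. -/
theorem IsAbelian.swap {B : M.Basis} (hB : B.IsAbelian) : B.swap.IsAbelian := by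
  obtain ⟨c, hc0, hci⟩ := B.exists_unit
  obtain ⟨g, ⟨hg, hg2⟩, -⟩ := M.sharplyTransitive c B.inf B.zero
    (fun h => hci (M.rel.symm h)) (fun h => hc0 (M.rel.symm h))
  have hU := M.conj_eq B.inf g (Subgroup.mem_iSup_of_mem c hg)
  rw [hg2] at hU
  intro a ha b hb
  change a ∈ M.U B.zero at ha
  change b ∈ M.U B.zero at hb
  rw [← hU] at ha hb
  obtain ⟨a, ha, rfl⟩ := ha
  obtain ⟨b, hb, rfl⟩ := hb
  rw [← map_mul, ← map_mul, hB a ha b hb]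

/-- The `ℤ`-module `V⁺ = X ∖ [∞]`, with `x + z = 0 α_x α_z`, when `U_∞` is abelian. The `ℤ`-module
`V⁻ = X ∖ [0]` is the same construction for the basis `B.swap = (∞, 0)`. -/
def V (B : M.Basis) (_hB : B.IsAbelian) : Type u := B.Aff

noncomputable instance (B : M.Basis) (hB : B.IsAbelian) : Add (B.V hB) := ⟨fun x z => B.add x z⟩

noncomputable instance (B : M.Basis) (hB : B.IsAbelian) : Zero (B.V hB) :=
  ⟨B.orbitPt 1 (one_mem _)⟩

noncomputable instance (B : M.Basis) (hB : B.IsAbelian) : Neg (B.V hB) := ⟨fun x => B.neg x⟩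

noncomputable instance (B : M.Basis) (hB : B.IsAbelian) : AddCommGroup (B.V hB) where
  nsmul := nsmulRec
  zsmul := zsmulRec
  add_assoc x y z := by
    apply B.alpha_injective
    change B.alpha (B.add (B.add x y) z) = B.alpha (B.add x (B.add y z))
    simp only [add, alpha_orbitPt, mul_assoc]
  zero_add x := by
    apply B.alpha_injective
    change B.alpha (B.add (B.orbitPt 1 _) x) = B.alpha x
    simp only [add, alpha_orbitPt, mul_one]
  add_zero x := by
    apply B.alpha_injective
    change B.alpha (B.add x (B.orbitPt 1 _)) = B.alpha x
    simp only [add, alpha_orbitPt, one_mul]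
  neg_add_cancel x := by
    apply B.alpha_injective
    change B.alpha (B.add (B.neg x) x) = B.alpha (B.orbitPt 1 _)
    simp only [add, neg, alpha_orbitPt, mul_inv_cancel]
  add_comm x y := by
    apply B.alpha_injective
    change B.alpha (B.add x y) = B.alpha (B.add y x)
    simp only [add, alpha_orbitPt]
    exact hB _ (B.alpha_mem y) _ (B.alpha_mem x)

/-- The abelian group `V⁺`. -/
abbrev VPlus (B : M.Basis) (hB : B.IsAbelian) : Type u := B.V hB

/-- The abelian group `V⁻`. -/
abbrev VMinus (B : M.Basis) (hB : B.IsAbelian) : Type u := B.swap.V hB.swap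

/-- The underlying point of an element of `V⁺` (or of `V⁻`, for `B.swap`). -/
def V.pt {B : M.Basis} {hB : B.IsAbelian} (x : B.V hB) : X := Subtype.val x

/-- The bilinear map `b` extends `(x, z) ↦ μ_{x+z} - μ_x - μ_z : V⁻ → V⁺`, defined for units
`x`, `z` such that `x + z` is a unit. -/
def ExtendsMuPlus (B : M.Basis) (hB : B.IsAbelian)
    (b : B.VPlus hB →ₗ[ℤ] B.VPlus hB →ₗ[ℤ] B.VMinus hB →ₗ[ℤ] B.VPlus hB) : Prop :=
  ∀ (x z : B.VPlus hB) (hx : B.IsUnit x.pt) (hz : B.IsUnit z.pt) (hxz : B.IsUnit (x + z).pt)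
    (y : B.VMinus hB),
    b x z y = (show B.VPlus hB from B.muPlus (x + z).pt hxz y)
      - (show B.VPlus hB from B.muPlus x.pt hx y) - (show B.VPlus hB from B.muPlus z.pt hz y)

/-- The bilinear map `b` extends `(y, w) ↦ μ_{y+w} - μ_y - μ_w : V⁺ → V⁻`, defined for units
`y`, `w` such that `y + w` is a unit; the operations here are those of `V⁻`. -/
def ExtendsMuMinus (B : M.Basis) (hB : B.IsAbelian)
    (b : B.VMinus hB →ₗ[ℤ] B.VMinus hB →ₗ[ℤ] B.VPlus hB →ₗ[ℤ] B.VMinus hB) : Prop :=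
  ∀ (y w : B.VMinus hB) (hy : B.IsUnit y.pt) (hw : B.IsUnit w.pt) (hyw : B.IsUnit (y + w).pt)
    (x : B.VPlus hB),
    b y w x = (show B.VMinus hB from B.muMinus (y + w).pt hyw x)
      - (show B.VMinus hB from B.muMinus y.pt hy x) - (show B.VMinus hB from B.muMinus w.pt hw x)

end Basis

end LocalMoufangSet

/-! ## Jordan pairs

`Q x y` stands for `y Q_x`. -/

namespace JordanPair

section

variable {k : Type w} [CommRing k] {A : Type u} {B : Type v} [AddCommGroup A] [AddCommGroup B]
  [Module k A] [Module k B]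

/-- The triple product `{x y z} = y Q_{x,z} = y (Q_{x+z} - Q_x - Q_z)`. -/
def triple (Q : QuadraticMap k A (B →ₗ[k] A)) (x : A) (y : B) (z : A) : A :=
  (Q (x + z) - Q x - Q z) y

/-- The three Jordan pair identities for `x ∈ A = V^σ`, with `B = V^{-σ}`. -/
structure Identities (Q : QuadraticMap k A (B →ₗ[k] A)) (Q' : QuadraticMap k B (A →ₗ[k] B)) :
    Prop where
  jp1 : ∀ (x : A) (y z : B), triple Q x y (Q x z) = Q x (triple Q' y x z)
  jp2 : ∀ (x z : A) (y : B), triple Q (Q x y) y z = triple Q x (Q' y x) z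
  jp3 : ∀ (x : A) (y z : B), Q (Q x y) z = Q x (Q' y (Q x z))

/-- `Q'` is the scalar extension of `Q` to the commutative `k`-algebra `l`. -/
def IsScalarExtension {l : Type*} [CommRing l] [Algebra k l] (Q : QuadraticMap k A (B →ₗ[k] A))
    (Q' : QuadraticMap l (l ⊗[k] A) (l ⊗[k] B →ₗ[l] l ⊗[k] A)) : Prop :=
  ∀ (x : A) (y : B), Q' (1 ⊗ₜ[k] x) (1 ⊗ₜ[k] y) = 1 ⊗ₜ[k] Q x y

/-- The scalar extension of a quadratic map is unique. -/
theorem IsScalarExtension.unique {l : Type*} [CommRing l] [Algebra k l]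
    {Q : QuadraticMap k A (B →ₗ[k] A)}
    {Q₁ Q₂ : QuadraticMap l (l ⊗[k] A) (l ⊗[k] B →ₗ[l] l ⊗[k] A)}
    (h₁ : IsScalarExtension Q Q₁) (h₂ : IsScalarExtension Q Q₂) : Q₁ = Q₂ := by
  refine baseChange_ext (R := k) (A := l) (M₂ := A) (N₁ := l ⊗[k] B →ₗ[l] l ⊗[k] A) ?_
  intro x
  apply TensorProduct.AlgebraTensorModule.curry_injective
  ext y
  simpa using (h₁ x y).trans (h₂ x y).symm

/-- `(A, B)` with the quadratic maps `Qp`, `Qm` is a Jordan pair over `k`: the identities hold, for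
both signs, in all scalar extensions `l` of `k`. -/
def IsJordanPair (Qp : QuadraticMap k A (B →ₗ[k] A)) (Qm : QuadraticMap k B (A →ₗ[k] B)) :
    Prop :=
  Identities Qp Qm ∧ Identities Qm Qp ∧
  ∀ (l : Type t) [CommRing l] [Algebra k l],
    ∃ (Qp' : QuadraticMap l (l ⊗[k] A) (l ⊗[k] B →ₗ[l] l ⊗[k] A))
      (Qm' : QuadraticMap l (l ⊗[k] B) (l ⊗[k] A →ₗ[l] l ⊗[k] B)),
      IsScalarExtension Qp Qp' ∧ IsScalarExtension Qm Qm' ∧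
        Identities Qp' Qm' ∧ Identities Qm' Qp'

/-- `x` is invertible if `Q_x` is. -/
def IsInvertible (Q : QuadraticMap k A (B →ₗ[k] A)) (x : A) : Prop := Function.Bijective (Q x)

/-- The conditions on an ideal `(I, I')` for `x ∈ I ⊆ A`; an ideal satisfies them for both signs. -/
def IdealConditions (Q : QuadraticMap k A (B →ₗ[k] A)) (Q' : QuadraticMap k B (A →ₗ[k] B))
    (I : Submodule k A) (I' : Submodule k B) : Prop :=
  ∀ x ∈ I, ∀ (y : B) (z : A), Q' y x ∈ I' ∧ Q x y ∈ I ∧ triple Q x y z ∈ I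

/-- `(I, I')` is an ideal of the pair. -/
def IsIdeal (Qp : QuadraticMap k A (B →ₗ[k] A)) (Qm : QuadraticMap k B (A →ₗ[k] B))
    (I : Submodule k A) (I' : Submodule k B) : Prop :=
  IdealConditions Qp Qm I I' ∧ IdealConditions Qm Qp I' I

/-- The pair is local: the non-invertible elements form a proper ideal. -/
def IsLocal (Qp : QuadraticMap k A (B →ₗ[k] A)) (Qm : QuadraticMap k B (A →ₗ[k] B)) : Prop :=
  ∃ (I : Submodule k A) (I' : Submodule k B),
    (∀ x, x ∈ I ↔ ¬ IsInvertible Qp x) ∧ (∀ y, y ∈ I' ↔ ¬ IsInvertible Qm y) ∧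
      IsIdeal Qp Qm I I' ∧ ¬ (I = ⊤ ∧ I' = ⊤)

/-- The Bergman operator `B_{x,y} = id - D_{x,y} + Q_y Q_x` on `V⁺`, where `z D_{x,y} = {x y z}`. -/
def bergman (Qp : QuadraticMap k A (B →ₗ[k] A)) (Qm : QuadraticMap k B (A →ₗ[k] B))
    (x : A) (y : B) (z : A) : A :=
  z - triple Qp x y z + Qp x (Qm y z)

/-- `(x, y)` is quasi-invertible if `B_{x,y}` is invertible. -/
def IsQuasiInvertible (Qp : QuadraticMap k A (B →ₗ[k] A)) (Qm : QuadraticMap k B (A →ₗ[k] B))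
    (x : A) (y : B) : Prop :=
  Function.Bijective (bergman Qp Qm x y)

/-- The component in `V⁺` of the Jacobson radical. -/
def radPlus (Qp : QuadraticMap k A (B →ₗ[k] A)) (Qm : QuadraticMap k B (A →ₗ[k] B)) : Set A :=
  {x | ∀ y, IsQuasiInvertible Qp Qm x y}

/-- The component in `V⁻` of the Jacobson radical. -/
def radMinus (Qp : QuadraticMap k A (B →ₗ[k] A)) (Qm : QuadraticMap k B (A →ₗ[k] B)) : Set B :=
  {y | ∀ x, IsQuasiInvertible Qp Qm x y}

end

end JordanPair

/-- The abelian group `A` is uniquely `n`-divisible. -/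
def UniquelyDivisible (n : ℕ) (A : Type u) [AddCommGroup A] : Prop := ∀ a : A, ∃! b : A, n • b = a

/-! Speciality says that the negatives of a unit in V⁺ and in V⁻ are the same point (`NegSwap`).
Hence μ_x is a palindromic word in α_x and β_x (`mu_eq`, `mu_eq'`), and computing in the group gives
the rules collected in `MuUnits`: passing to the basis (∞, 0) inverts μ_x, the μ-map of the point
μ_x(y) is a conjugate of μ_y⁻¹, and there are formulas for the μ-map of a sum taken in V⁻ and for
the value of μ_{x+z} at x.

With the biadditive maps of (J4), μ_{3x} = 6μ_x + 3μ_{-x} and μ_{4x} = 10μ_x + 6μ_{-x}. As μ-maps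
are bijective, 2 and 3 act bijectively. Then μ_{-x} = μ_x follows, so Q_x = μ_x for every unit x.

The Jordan identities are at first known only at units, sometimes only when sums of these are units
too. Closure of units under doubling and tripling lets an identity that is additive or quadratic in
an argument spread to the whole module (`eq_zero_of_near`, `eq_zero_of_quadratic`). The central
relation is `hat_shift`, which trades a middle entry `hat b` for an outer entry `b`. It gives the
first Jordan identity, and the degree-two part of the fundamental formula gives the second. Both
combine into a five-linear identity. Being multilinear, it survives scalar extension; as 3 acts
bijectively, it returns all three axioms there.

For the radical, the Bergman operator B of a pair with a nonunit entry is the identity modulo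
nonunits, so it preserves units. The formula Q_{Bz} = B Q_z B′ (`berg_quad`) then makes B bijective.
For a unit x, B vanishes at (x, -`hat x`), which keeps units out of the radical. -/

/-! ## Additive maps that vanish on units -/

section Units

variable {A : Type*} {L : Type*} [AddCommGroup A] [AddCommGroup L]

/-- The complement of the proper subgroup `N` (the set of "units") is closed under multiplication
by `2` and by `3`. -/
structure UnitComplement (N : AddSubgroup A) : Prop where
  exists_unit : ∃ x, x ∉ N
  two : ∀ x, x ∉ N → x + x ∉ N
  three : ∀ x, x ∉ N → x + x + x ∉ N

namespace UnitComplement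

variable {N : AddSubgroup A}

theorem neg_notMem {x : A} (hx : x ∉ N) : -x ∉ N := fun h => hx (by simpa using h)

theorem add_mem_notMem {x n : A} (hx : x ∉ N) (hn : n ∈ N) : x + n ∉ N :=
  fun h => hx ((N.add_mem_cancel_right hn).1 h)

/-- Of two units, the sum or the difference is a unit. -/
theorem add_or_sub (hN : UnitComplement N) {x z : A} (hx : x ∉ N) : x + z ∉ N ∨ x - z ∉ N := by
  by_contra! h
  apply hN.two x hx
  have := N.add_mem h.1 h.2
  rwa [show x + z + (x - z) = x + x by abel] at this

/-- A nonunit `x` is the difference of the units `e + x` and `e`. -/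
theorem eq_zero_of_units (hN : UnitComplement N) (f : A → L)
    (hadd : ∀ a b, f (a + b) = f a + f b) (h : ∀ x, x ∉ N → f x = 0) (x : A) : f x = 0 := by
  obtain ⟨e, he⟩ := hN.exists_unit
  by_cases hx : x ∈ N
  · have h1 := h _ (add_mem_notMem he hx)
    rwa [hadd, h e he, zero_add] at h1
  · exact h x hx

/-- Serves to linearize at a unit `x`, where an identity is available at `x + z`, `x - z` and `z`
only if all three are units. The point `2x + n` with `n ∈ N` qualifies, because `3x` and `-x` are
units; so `f` kills `x` and `N`. Any other `z` that fails the test is `±x` modulo `N`. -/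
theorem eq_zero_of_near (hN : UnitComplement N) (htf : ∀ m : L, m + m = 0 → m = 0) (f : A → L)
    (hadd : ∀ a b, f (a + b) = f a + f b) {x : A} (hx : x ∉ N)
    (h : ∀ z, z ∉ N → x + z ∉ N → x - z ∉ N → f z = 0) (z : A) : f z = 0 := by
  have hneg : ∀ a, f (-a) = - f a := fun a => (AddMonoidHom.mk' f hadd).map_neg a
  have h2 : f (x + x) = 0 := by
    apply h _ (hN.two x hx)
    · rw [← add_assoc]; exact hN.three x hx
    · rw [show x - (x + x) = -x by abel]; exact neg_notMem hx
  have hfx : f x = 0 := htf _ (by rw [← hadd, h2])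
  have hn : ∀ n ∈ N, f n = 0 := by
    intro n hn
    have h3 : f (x + x + n) = 0 := by
      apply h _ (add_mem_notMem (hN.two x hx) hn)
      · rw [show x + (x + x + n) = x + x + x + n by abel]
        exact add_mem_notMem (hN.three x hx) hn
      · rw [show x - (x + x + n) = -x + -n by abel]
        exact add_mem_notMem (neg_notMem hx) (neg_mem hn)
    rwa [hadd, h2, zero_add] at h3
  by_cases hz : z ∈ N
  · exact hn z hz
  by_cases h1 : x + z ∈ N
  · have := hn _ h1
    rwa [hadd, hfx, zero_add] at this
  by_cases h3 : x - z ∈ N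
  · have := hn _ h3
    rw [sub_eq_add_neg, hadd, hfx, zero_add, hneg] at this
    exact neg_eq_zero.1 this
  exact h z hz h1 h3

/-- A biadditive map vanishes if it vanishes on pairs of units whose sum is a unit. -/
theorem eq_zero_of_biadditive (hN : UnitComplement N) (htf : ∀ m : L, m + m = 0 → m = 0)
    (f : A → A → L) (hl : ∀ a b c, f (a + b) c = f a c + f b c)
    (hr : ∀ a b c, f a (b + c) = f a b + f a c)
    (h : ∀ x z, x ∉ N → z ∉ N → x + z ∉ N → f x z = 0) (x z : A) : f x z = 0 :=
  hN.eq_zero_of_units (fun x => f x z) (fun a b => hl a b z)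
    (fun x hx => hN.eq_zero_of_near htf (f x) (hr x) hx (fun z hz h1 _ => h x z hx hz h1) z) x

theorem eq_zero_of_diag (htf : ∀ m : L, m + m = 0 → m = 0) (f : A → A → L)
    (hl : ∀ a b c, f (a + b) c = f a c + f b c) (hs : ∀ a b, f a b = f b a)
    (h : ∀ x, f x x = 0) (x z : A) : f x z = 0 := by
  have h1 := h (x + z)
  rw [hl, hs x, hs z, hl, hl, h x, h z, hs z x] at h1
  exact htf _ (by simpa using h1)

/-- A symmetric biadditive map vanishes if its diagonal vanishes on units. -/
theorem eq_zero_of_quadratic (hN : UnitComplement N) (htf : ∀ m : L, m + m = 0 → m = 0)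
    (f : A → A → L) (hl : ∀ a b c, f (a + b) c = f a c + f b c)
    (hs : ∀ a b, f a b = f b a) (h : ∀ x, x ∉ N → f x x = 0) (x z : A) : f x z = 0 := by
  have hr : ∀ a b c, f a (b + c) = f a b + f a c := fun a b c => by
    rw [hs, hl, hs b, hs c]
  refine hN.eq_zero_of_biadditive htf f hl hr (fun x z hx hz hxz => ?_) x z
  have h1 := h _ hxz
  rw [hl, hr, hr, h x hx, h z hz, hs z x] at h1
  exact htf _ (by simpa using h1)

/-- The quadratic analogue of `eq_zero_of_near`, with the same test points `2x + n`. -/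
theorem eq_zero_of_near_quadratic (hN : UnitComplement N) (htf : ∀ m : L, m + m = 0 → m = 0)
    (f : A → A → L) (hl : ∀ a b c, f (a + b) c = f a c + f b c)
    (hs : ∀ a b, f a b = f b a) {x : A} (hx : x ∉ N)
    (h : ∀ z, z ∉ N → x + z ∉ N → x - z ∉ N → f z z = 0) (y z : A) : f y z = 0 := by
  have hr : ∀ a b c, f a (b + c) = f a b + f a c := fun a b c => by
    rw [hs, hl, hs b, hs c]
  have hnl : ∀ a c, f (-a) c = - f a c := fun a c =>
    (AddMonoidHom.mk' (fun a => f a c) (fun a b => hl a b c)).map_neg a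
  have hnr : ∀ a c, f c (-a) = - f c a := fun a c =>
    (AddMonoidHom.mk' (f c) (hr c)).map_neg a
  refine eq_zero_of_diag htf f hl hs (fun z => ?_) y z
  have hxn : ∀ n ∈ N, x + x + n ∉ N ∧ x + (x + x + n) ∉ N ∧ x - (x + x + n) ∉ N := by
    intro n hn
    refine ⟨add_mem_notMem (hN.two x hx) hn, ?_, ?_⟩
    · rw [show x + (x + x + n) = x + x + x + n by abel]
      exact add_mem_notMem (hN.three x hx) hn
    · rw [show x - (x + x + n) = -x + -n by abel]
      exact add_mem_notMem (neg_notMem hx) (neg_mem hn)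
  have hq : ∀ n ∈ N, f (x + x + n) (x + x + n) = 0 := fun n hn =>
    h _ (hxn n hn).1 (hxn n hn).2.1 (hxn n hn).2.2
  have h2 : f x x = 0 := by
    have := hq 0 N.zero_mem
    simp only [add_zero, hl, hr] at this
    exact htf _ (htf _ this)
  have hn : ∀ n ∈ N, f n n = 0 ∧ f x n = 0 := by
    intro n hn
    -- At `2x + n` and `2x - n` the cross terms have opposite signs: the sum isolates `f n n`, after
    -- which either equation isolates `f x n`.
    have h3 := hq n hn
    have h4 := hq (-n) (neg_mem hn)
    simp only [hl, hr, hnl, hnr, h2, hs n x] at h3 h4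
    have h5 : f n n = 0 := htf _ (by
      have h6 := congrArg₂ (fun a b : L => a + b) h3 h4
      rw [add_zero] at h6
      rw [← h6]; abel)
    refine ⟨h5, ?_⟩
    rw [h5] at h3
    exact htf _ (htf _ (by rw [← h3]; abel))
  by_cases hz : z ∈ N
  · exact (hn z hz).1
  by_cases h1 : x + z ∈ N
  · obtain ⟨ha, hb⟩ := hn _ h1
    rw [hr, h2, zero_add] at hb
    simpa [hl, hr, h2, hb, hs z x] using ha
  by_cases h3 : x - z ∈ N
  · obtain ⟨ha, hb⟩ := hn _ h3
    rw [sub_eq_add_neg, hr, h2, zero_add, hnr, neg_eq_zero] at hb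
    simpa [sub_eq_add_neg, hl, hr, h2, hb, hs z x, hnl, hnr] using ha
  exact h z hz h1 h3

end UnitComplement

end Units

/-! ## From identities for units to the five-linear Jordan pair identity

Below `S x z y` stands for `{x y z} / 2`, so that `y Q_x` is `S x x y`. -/

section JordanUnits

variable {A : Type*} {C : Type*} [AddCommGroup A] [AddCommGroup C]

/-- The properties of a pair of trilinear maps that come from a local Moufang set, for one of the
two signs. Elements outside `N` are the units, and `hat` sends a unit `x` to the same point of the
Moufang set, viewed in `V^{-σ}`; it is the negative of the Jordan inverse of `x`. -/
structure JordanUnits (N : AddSubgroup A) (N' : AddSubgroup C) (hat : A → C) (hat' : C → A)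
    (S : A →ₗ[ℤ] A →ₗ[ℤ] C →ₗ[ℤ] A) (S' : C →ₗ[ℤ] C →ₗ[ℤ] A →ₗ[ℤ] C) : Prop where
  uc : UnitComplement N
  tf2 : ∀ a : A, a + a = 0 → a = 0
  tf3 : ∀ a : A, a + a + a = 0 → a = 0
  hat_notMem : ∀ x, x ∉ N → hat x ∉ N'
  hat_hat : ∀ x, x ∉ N → hat' (hat x) = x
  hat_neg : ∀ x, x ∉ N → hat (-x) = - hat x
  symm : ∀ x z, S x z = S z x
  hat_right : ∀ x z, x ∉ N → S x z (hat x) = -z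
  inv : ∀ x y, x ∉ N → S' (hat x) (hat x) (S x x y) = y
  ff : ∀ x y z, x ∉ N → y ∉ N' → S (S x x y) (S x x y) z = S x x (S' y y (S x x z))
  map_notMem : ∀ x y, x ∉ N → y ∉ N' → S x x y ∉ N
  k2 : ∀ a b y, a ∉ N → b ∉ N → a + b ∉ N →
    S' (hat a) (hat b) (S a a y) = S' (hat b) (hat b) (S a b y)
  add_mem : ∀ x n y, x ∉ N → n ∈ N → S (x + n) (x + n) y - S x x y ∈ N

namespace JordanUnits

variable {N : AddSubgroup A} {N' : AddSubgroup C} {hat : A → C} {hat' : C → A}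
  {S : A →ₗ[ℤ] A →ₗ[ℤ] C →ₗ[ℤ] A} {S' : C →ₗ[ℤ] C →ₗ[ℤ] A →ₗ[ℤ] C}

theorem inv_right (h : JordanUnits N N' hat hat' S S') (h' : JordanUnits N' N hat' hat S' S)
    {x : A} (hx : x ∉ N) (z : A) : S x x (S' (hat x) (hat x) z) = z := by
  have := h'.inv (hat x) z (h.hat_notMem x hx)
  rwa [h.hat_hat x hx] at this

theorem ff_polar (h : JordanUnits N N' hat hat' S S') (h' : JordanUnits N' N hat' hat S' S)
    {x : A} (hx : x ∉ N) (y w : C) (z : C) :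
    S (S x x y) (S x x w) z = S x x (S' y w (S x x z)) := by
  rw [← sub_eq_zero]
  refine h'.uc.eq_zero_of_quadratic h.tf2
    (fun y w => S (S x x y) (S x x w) z - S x x (S' y w (S x x z))) ?_ ?_ ?_ y w
  · intro a b c
    simp only [map_add, LinearMap.add_apply]; abel
  · intro a b
    simp only [h.symm (S x x a), h'.symm a]
  · intro y hy
    simp only [h.ff x y z hx hy, sub_self]

/-- If `a + b` is not a unit then `a - b` is, and both sides are odd in `b`. -/
theorem k2_units (h : JordanUnits N N' hat hat' S S') {a b : A} (ha : a ∉ N) (hb : b ∉ N) (y : C) :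
    S' (hat a) (hat b) (S a a y) = S' (hat b) (hat b) (S a b y) := by
  rcases h.uc.add_or_sub (z := b) ha with h1 | h1
  · exact h.k2 a b y ha hb h1
  · have := h.k2 a (-b) y ha (UnitComplement.neg_notMem hb) (by rwa [← sub_eq_add_neg])
    simpa [h.hat_neg b hb] using this

/-- The diagonal case of `hat_shift`. It comes from `k2_units` at an argument that `S b b` sends to
`a`. -/
theorem mixed_units (h : JordanUnits N N' hat hat' S S') (h' : JordanUnits N' N hat' hat S' S)
    {a b : A} (ha : a ∉ N) (hb : b ∉ N) :
    S b a (S' (hat b) (hat b) a) = - S a a (hat b) := by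
  have h1 := h.k2_units hb ha (S' (hat b) (hat b) a)
  rw [h.inv_right h' hb, h'.symm] at h1
  have h2 := h'.hat_right (hat a) (hat b) (h.hat_notMem a ha)
  rw [h.hat_hat a ha] at h2
  rw [h2] at h1
  have h3 := congrArg (S a a) h1
  rw [h.inv_right h' ha, map_neg] at h3
  exact h3.symm

/-- Polarizing `mixed_units` yields only the symmetrization of `hat_shift` in `v` and `z`;
separating the two terms takes the cubic identities that follow. -/
theorem hat_symm_sum (h : JordanUnits N N' hat hat' S S') (h' : JordanUnits N' N hat' hat S' S)
    {b : A} (hb : b ∉ N) (v z : A) :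
    S v z (hat b) + S v z (hat b) + S b z (S' (hat b) (hat b) v)
      + S b v (S' (hat b) (hat b) z) = 0 := by
  refine h.uc.eq_zero_of_quadratic h.tf2
    (fun v z => S v z (hat b) + S v z (hat b) + S b z (S' (hat b) (hat b) v)
      + S b v (S' (hat b) (hat b) z)) ?_ ?_ ?_ v z
  · intro a c d
    simp only [map_add, LinearMap.add_apply]; abel
  · intro a c
    simp only [h.symm a c]; abel
  · intro a ha
    simp only [h.mixed_units h' ha hb]; abel

/-- `hat_symm_sum` at two elements of the image of `S b b`; the result is the first Jordan identity
symmetrized in `y` and `w`. -/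
theorem cubic_symm (h : JordanUnits N N' hat hat' S S') (h' : JordanUnits N' N hat' hat S' S)
    {b : A} (hb : b ∉ N) (y w : C) :
    S b (S b b w) y + S b (S b b y) w - S b b (S' y w b) - S b b (S' y w b) = 0 := by
  have h1 := h.hat_symm_sum h' hb (S b b y) (S b b w)
  rw [h.inv b y hb, h.inv b w hb, h.ff_polar h' hb, h.hat_right b b hb] at h1
  simp only [map_neg] at h1
  rw [← h1]; abel

theorem cubic_symm_linear (h : JordanUnits N N' hat hat' S S')
    (h' : JordanUnits N' N hat' hat S' S) {b : A} (hb : b ∉ N) (z : A) (y w : C) :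
    S z (S b b w) y + 2 • S b (S b z w) y + S z (S b b y) w + 2 • S b (S b z y) w
      - 4 • S b z (S' y w b) - 2 • S b b (S' y w z) = 0 := by
  refine h.uc.eq_zero_of_near h.tf2 (fun z => S z (S b b w) y + 2 • S b (S b z w) y
    + S z (S b b y) w + 2 • S b (S b z y) w
      - 4 • S b z (S' y w b) - 2 • S b b (S' y w z)) ?_ hb ?_ z
  · intro a c
    simp only [map_add, LinearMap.add_apply, smul_add]; abel
  · intro z hz h1 h2
    apply h.tf2
    have e1 := h.cubic_symm h' h1 y w
    have e2 := h.cubic_symm h' h2 y w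
    have e3 := h.cubic_symm h' hz y w
    have e4 := h.symm z b
    simp only [map_add, map_sub, LinearMap.add_apply, LinearMap.sub_apply, e4] at e1 e2
    -- For a homogeneous cubic `f`, `f (b + z) - f (b - z) - 2 f z` is twice the part linear in `z`.
    have e5 := congrArg₂ (fun a b : A => a - b) e1 e2
    have e6 := congrArg₂ (fun a b : A => a - b - b) e5 e3
    simp only [sub_zero] at e6
    rw [← e6]
    abel

/-- The maps `{v x̂ z}` and `{x v' z}`, `v' = v Q_x⁻¹`, are opposite. -/
theorem hat_shift (h : JordanUnits N N' hat hat' S S') (h' : JordanUnits N' N hat' hat S' S)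
    {b : A} (hb : b ∉ N) (v z : A) :
    S v z (hat b) = - S b z (S' (hat b) (hat b) v) := by
  -- The linearized identity at `y = hat b` and `w = S' (hat b) (hat b) v` is not symmetric in `v`
  -- and `z`, whereas the left side here is. Exchanging them shows that three times the difference
  -- of the two right-hand terms vanishes.
  have key : ∀ v z : A, S v z (hat b) = S b z (S' (hat b) (hat b) v)
      - 2 • S b v (S' (hat b) (hat b) z) := by
    intro v z
    have e := h.cubic_symm_linear h' hb z (hat b) (S' (hat b) (hat b) v)
    have hbb := h'.hat_right (hat b) (S' (hat b) (hat b) v) (h.hat_notMem b hb)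
    rw [h.hat_hat b hb] at hbb
    have e2 : S b b (S' (hat b) (S' (hat b) (hat b) v) z)
        = - S b v (S' (hat b) (hat b) z) := by
      have := h.ff_polar h' hb (hat b) (S' (hat b) (hat b) v) (S' (hat b) (hat b) z)
      rw [h.inv_right h' hb, h.inv_right h' hb, h.hat_right b b hb] at this
      rw [← this]; simp
    rw [h.inv_right h' hb, h.hat_right b _ hb, h.hat_right b _ hb, h.hat_right b _ hb, hbb, e2,
      h.symm z v] at e
    simp only [map_neg, LinearMap.neg_apply, h.symm z b] at e
    rw [← sub_eq_zero, ← e]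
    abel
  have e1 := key v z
  have e2 := key z v
  rw [h.symm z v] at e2
  have e3 : S b z (S' (hat b) (hat b) v) - S b v (S' (hat b) (hat b) z) = 0 := by
    apply h.tf3
    have := e1.symm.trans e2
    rw [← sub_eq_zero] at this
    rw [← this]; abel
  rw [sub_eq_zero] at e3
  rw [e1, ← e3]; abel

/-- `hat_shift` at two elements of the image of `S b b`, with `ff_polar` for its left side. -/
theorem jp1_units (h : JordanUnits N N' hat hat' S S') (h' : JordanUnits N' N hat' hat S' S)
    {b : A} (hb : b ∉ N) (y w : C) : S b (S b b w) y = S b b (S' y w b) := by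
  have := h.hat_shift h' hb (S b b y) (S b b w)
  rw [h.ff_polar h' hb, h.inv b y hb, h.hat_right b b hb] at this
  simpa using this.symm

theorem jp1_linear (h : JordanUnits N N' hat hat' S S') (h' : JordanUnits N' N hat' hat S' S)
    {b : A} (hb : b ∉ N) (z : A) (y w : C) :
    S z (S b b w) y + 2 • S b (S b z w) y - 2 • S b z (S' y w b) - S b b (S' y w z) = 0 := by
  refine h.uc.eq_zero_of_near h.tf2 (fun z => S z (S b b w) y + 2 • S b (S b z w) y
      - 2 • S b z (S' y w b) - S b b (S' y w z)) ?_ hb ?_ z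
  · intro a c
    simp only [map_add, LinearMap.add_apply, smul_add]; abel
  · intro z hz h1 h2
    apply h.tf2
    have e1 := h.jp1_units h' h1 y w
    have e2 := h.jp1_units h' h2 y w
    have e3 := h.jp1_units h' hz y w
    have e4 := h.symm z b
    rw [← sub_eq_zero] at e1 e2 e3
    simp only [map_add, map_sub, LinearMap.add_apply, LinearMap.sub_apply, e4] at e1 e2
    have e5 := congrArg₂ (fun a b : A => a - b) e1 e2
    have e6 := congrArg₂ (fun a b : A => a - b - b) e5 e3
    simp only [sub_zero] at e6
    rw [← e6]
    abel

/-- The complete linearization of the first Jordan pair identity. -/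
theorem jp1_polar (h : JordanUnits N N' hat hat' S S') (h' : JordanUnits N' N hat' hat S' S)
    (x u z : A) (y w : C) :
    S z (S x u w) y + S x (S u z w) y + S u (S x z w) y
      = S x z (S' y w u) + S u z (S' y w x) + S x u (S' y w z) := by
  rw [← sub_eq_zero]
  refine h.uc.eq_zero_of_quadratic h.tf2 (fun x u => S z (S x u w) y + S x (S u z w) y
    + S u (S x z w) y - (S x z (S' y w u) + S u z (S' y w x) + S x u (S' y w z))) ?_ ?_ ?_ x u
  · intro a b c
    simp only [map_add, LinearMap.add_apply]; abel
  · intro a b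
    simp only [h.symm a b]; abel
  · intro b hb
    rw [← h.jp1_linear h' hb z y w]
    abel

/-- In the isotope with product `S s t (hat x)` this is the polarized Jordan algebra rule U_v =
2L_v² - L_{v²}. It is the part of degree two in `v` of the fundamental formula at `x + v`, with `y =
hat x`: adding the instances at `x + v` and `x - v` removes odd degrees, and the instance at `v`
removes degree four. -/
theorem square_formula (h : JordanUnits N N' hat hat' S S') (h' : JordanUnits N' N hat' hat S' S)
    {x : A} (hx : x ∉ N) (s z t : A) :
    S s z (S' (hat x) (hat x) t) = S s (S z t (hat x)) (hat x) + S z (S s t (hat x)) (hat x)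
      - S t (S s z (hat x)) (hat x) := by
  rw [← sub_eq_zero]
  refine h.uc.eq_zero_of_near_quadratic h.tf2 (fun s z => S s z (S' (hat x) (hat x) t) -
    (S s (S z t (hat x)) (hat x) + S z (S s t (hat x)) (hat x)
      - S t (S s z (hat x)) (hat x))) ?_ ?_ hx ?_ s z
  · intro a b c
    simp only [map_add, LinearMap.add_apply]; abel
  · intro a b
    simp only [h.symm a b]; abel
  · intro v hv h1 h2
    have hxh := h.hat_notMem x hx
    set y := hat x with hy
    set w := S' y y t with hw
    have e1 := h.ff (x + v) y w h1 hxh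
    have e2 := h.ff (x - v) y w h2 hxh
    have e3 := h.ff v y w hv hxh
    have e4 : S x x w = t := h.inv_right h' hx t
    have e5 : ∀ z, S x z y = -z := fun z => h.hat_right x z hx
    have e6 : ∀ z, S' y y (S x x z) = z := fun z => h.inv x z hx
    have e7 : ∀ s, S x v (S' y y s) = - S s v y := fun s => by
      rw [h.hat_shift h' hx s v, neg_neg]
    have e8 : ∀ s, S x x (S' y y s) = s := fun s => h.inv_right h' hx s
    have e9 : S x (S v v y) w = - S t (S v v y) y := by
      rw [h.hat_shift h' hx t, neg_neg]
    have e10 : S x v w = - S t v y := e7 t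
    simp only [map_add, map_sub, LinearMap.add_apply, LinearMap.sub_apply, h.symm v x, e5, e8, e4,
      e10, e7, h.symm (S v v y) x, map_neg, LinearMap.neg_apply, h.symm (S v v y) v,
      e9, e3, ← hw] at e1 e2 ⊢
    rw [h.symm (S t v y) v, ← sub_eq_zero] at e1 e2
    rw [h.symm v t]
    have e11 := congrArg₂ (fun a b : A => a + b) e1 e2
    rw [add_zero] at e11
    apply h.tf2
    apply h.tf2
    rw [← e11]
    abel

/-- Add two instances of `square_formula`, with `S x x y` and `S x x v` in exchanged roles: the
first and last terms on the right cancel crosswise and the middle one doubles. -/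
theorem jp2_units (h : JordanUnits N N' hat hat' S S') (h' : JordanUnits N' N hat' hat S' S)
    {x : A} (hx : x ∉ N) (z : A) (y v : C) :
    S (S x x y) z v + S (S x x v) z y = 2 • S x z (S' y v x) := by
  have e1 := h.square_formula h' hx (S x x y) z (S x x v)
  have e2 := h.square_formula h' hx (S x x v) z (S x x y)
  rw [h.inv x v hx] at e1
  rw [h.inv x y hx, h.symm (S x x v) (S x x y)] at e2
  have e3 : S (S x x y) (S x x v) (hat x) = - S x x (S' y v x) := by
    rw [h.ff_polar h' hx, h.hat_right x x hx, map_neg, map_neg]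
  have e4 : S z (S x x (S' y v x)) (hat x) = - S x z (S' y v x) := by
    rw [h.symm z, h.hat_shift h' hx, h.inv x _ hx]
  rw [e3, map_neg, LinearMap.neg_apply, e4] at e1 e2
  rw [e1, e2, h.symm (S x x y) z, h.symm (S x x v) z]
  abel

/-- The complete linearization of the second Jordan pair identity. -/
theorem jp2_polar (h : JordanUnits N N' hat hat' S S') (h' : JordanUnits N' N hat' hat S' S)
    (x u z : A) (y v : C) :
    S (S x u y) z v + S (S x u v) z y = S x z (S' y v u) + S u z (S' y v x) := by
  rw [← sub_eq_zero]
  refine h.uc.eq_zero_of_quadratic h.tf2 (fun x u => S (S x u y) z v + S (S x u v) z y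
    - (S x z (S' y v u) + S u z (S' y v x))) ?_ ?_ ?_ x u
  · intro a b c
    simp only [map_add, LinearMap.add_apply]; abel
  · intro a b
    simp only [h.symm a b]; abel
  · intro b hb
    rw [h.jp2_units h' hb z y v]
    abel

/-- The five-linear identity that characterizes Jordan pairs without `2`- and `3`-torsion. -/
theorem five_linear (h : JordanUnits N N' hat hat' S S') (h' : JordanUnits N' N hat' hat S' S)
    (x u z : A) (y v : C) :
    S x (S u z v) y - S u (S x z y) v = S (S x u y) z v - S u z (S' y v x) := by
  have e1 := h.jp1_polar h' u z x v y
  have e2 := h.jp2_polar h' u z x y v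
  rw [h.symm (S u z y) x, h.symm (S u z v) x] at e2
  rw [h.symm x u, h.symm (S u x y) z, h.symm x z]
  rw [h'.symm v y, h.symm z x] at e1
  rw [h.symm z x] at e2 ⊢
  linear_combination (norm := abel) e2 - e1

end JordanUnits

end JordanUnits

/-! ## Jordan pairs from the five-linear identity -/

namespace JordanPair

section FiveLinear

variable {k : Type*} [CommRing k] {A : Type*} {C : Type*} [AddCommGroup A] [AddCommGroup C]
  [Module k A] [Module k C]

/-- The five-linear Jordan pair identity for one sign, where `S x z y` is half the triple product
`{x y z}`. -/
structure FiveLinear (S : A →ₗ[k] A →ₗ[k] C →ₗ[k] A) (S' : C →ₗ[k] C →ₗ[k] A →ₗ[k] C) : Prop where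
  symm : ∀ x z, S x z = S z x
  identity : ∀ (x u z : A) (y v : C),
    S x (S u z v) y - S u (S x z y) v = S (S x u y) z v - S u z (S' y v x)

variable {S : A →ₗ[k] A →ₗ[k] C →ₗ[k] A} {S' : C →ₗ[k] C →ₗ[k] A →ₗ[k] C}

theorem triple_toQuadraticMap (hs : ∀ x z, S x z = S z x) (x : A) (y : C) (z : A) :
    triple (LinearMap.BilinMap.toQuadraticMap S) x y z = S x z y + S x z y := by
  simp only [triple, LinearMap.BilinMap.toQuadraticMap_apply, map_add, LinearMap.add_apply,
    LinearMap.sub_apply, hs z x]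
  abel

namespace FiveLinear

/-- Let `D` be the left side minus its version with `y` and `v` exchanged. The five-linear identity
at `x = u = z` and its exchanged version subtract to `2D = -D`. -/
theorem jp1 (h : FiveLinear S S') (h' : FiveLinear S' S) (tf3 : ∀ a : A, a + a + a = 0 → a = 0)
    (x : A) (y v : C) : S x (S x x v) y = S x x (S' y v x) := by
  have e1 := h.identity x x x y v
  have e2 := h.identity x x x v y
  rw [h.symm (S x x y) x] at e1
  rw [h.symm (S x x v) x, h'.symm v y] at e2
  have e3 : S x (S x x v) y - S x (S x x y) v = 0 := by
    apply tf3
    have := congrArg₂ (fun a b : A => a - b) e1 e2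
    rw [← sub_eq_zero] at this
    rw [← this]; abel
  rw [e3] at e1
  rw [sub_eq_zero.1 e3, sub_eq_zero.1 e1.symm]

theorem jp2 (h : FiveLinear S S') (x z : A) (y : C) : S (S x x y) z y = S x z (S' y y x) := by
  have := h.identity x x z y y
  rw [sub_self] at this
  exact sub_eq_zero.1 this.symm

theorem derivation (h : FiveLinear S S') (x u : A) (y v : C) :
    S u (S x x y) v = S x (S u x v) y + S x (S u x v) y - S x x (S' v y u) := by
  have e := h.identity u x x v y
  rw [h.symm (S u x v) x] at e
  rw [sub_eq_iff_eq_add.1 e]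
  abel

/-- Two uses of `derivation`, one for each sign, linked by `jp1` and `jp2`; their doubled terms
cancel. -/
theorem jp3 (h : FiveLinear S S') (h' : FiveLinear S' S) (tf3 : ∀ a : A, a + a + a = 0 → a = 0)
    (x : A) (y w : C) : S (S x x y) (S x x y) w = S x x (S' y y (S x x w)) := by
  rw [h.derivation x (S x x y) y w, h.symm (S x x y) x, h.jp1 h' tf3, h.jp1 h' tf3, h'.symm w y,
    ← h'.jp2 y w x, h'.symm (S' y y x) w, h'.derivation y w x x, h'.symm w y]
  simp only [map_add, map_sub]
  abel

theorem identities (h : FiveLinear S S') (h' : FiveLinear S' S)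
    (tf3 : ∀ a : A, a + a + a = 0 → a = 0) :
    Identities (LinearMap.BilinMap.toQuadraticMap S) (LinearMap.BilinMap.toQuadraticMap S') where
  jp1 x y z := by
    simp only [triple_toQuadraticMap h.symm, triple_toQuadraticMap h'.symm,
      LinearMap.BilinMap.toQuadraticMap_apply, map_add, h.jp1 h' tf3]
  jp2 x z y := by
    simp only [triple_toQuadraticMap h.symm, LinearMap.BilinMap.toQuadraticMap_apply, h.jp2]
  jp3 x y z := by
    simp only [LinearMap.BilinMap.toQuadraticMap_apply, h.jp3 h' tf3]

end FiveLinear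

/-! ### Scalar extensions. -/

variable (l : Type*) [CommRing l] [Algebra k l]

/-- The scalar extension of a trilinear map. -/
noncomputable def trilinearBaseChange (S : A →ₗ[k] A →ₗ[k] C →ₗ[k] A) :
    l ⊗[k] A →ₗ[l] l ⊗[k] A →ₗ[l] l ⊗[k] C →ₗ[l] l ⊗[k] A :=
  (LinearMap.BilinMap.baseChange l S).compr₂
    (LinearMap.liftBaseChange l (LinearMap.baseChangeHom k l C A))

theorem trilinearBaseChange_tmul (S : A →ₗ[k] A →ₗ[k] C →ₗ[k] A) (a b c : l) (x z : A) (y : C) :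
    trilinearBaseChange l S (a ⊗ₜ x) (b ⊗ₜ z) (c ⊗ₜ y) = (a * b * c) ⊗ₜ S x z y := by
  simp [trilinearBaseChange, TensorProduct.smul_tmul', mul_comm]

/-- All terms are additive in each argument, so pure tensors suffice. This is why the five-linear
identity, and not the axioms themselves, is carried to the extension. -/
theorem FiveLinear.baseChange (h : FiveLinear S S') :
    FiveLinear (trilinearBaseChange l S) (trilinearBaseChange l S') where
  symm x z := by
    induction x using TensorProduct.induction_on with
    | zero => simp
    | add a b ha hb => rw [map_add, map_add, LinearMap.add_apply, ha, hb]
    | tmul a x =>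
      induction z using TensorProduct.induction_on with
      | zero => simp
      | add b c hb hc => rw [map_add, map_add, LinearMap.add_apply, hb, hc]
      | tmul b z =>
        ext y
        simp [trilinearBaseChange_tmul, h.symm x z, mul_comm]
  identity x u z y v := by
    rw [← sub_eq_zero]
    induction x using TensorProduct.induction_on with
    | zero => simp
    | add a b ha hb =>
      rw [← add_zero (0 : l ⊗[k] A)]; nth_rw 2 [← ha]; rw [← hb]
      simp only [map_add, LinearMap.add_apply]; abel
    | tmul a x =>
    induction u using TensorProduct.induction_on with
    | zero => simp
    | add a b ha hb =>
      rw [← add_zero (0 : l ⊗[k] A)]; nth_rw 2 [← ha]; rw [← hb]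
      simp only [map_add, LinearMap.add_apply]; abel
    | tmul b u =>
    induction z using TensorProduct.induction_on with
    | zero => simp
    | add a b ha hb =>
      rw [← add_zero (0 : l ⊗[k] A)]; nth_rw 2 [← ha]; rw [← hb]
      simp only [map_add, LinearMap.add_apply]; abel
    | tmul c z =>
    induction y using TensorProduct.induction_on with
    | zero => simp
    | add a b ha hb =>
      rw [← add_zero (0 : l ⊗[k] A)]; nth_rw 2 [← ha]; rw [← hb]
      simp only [map_add, LinearMap.add_apply]; abel
    | tmul d y =>
    induction v using TensorProduct.induction_on with
    | zero => simp
    | add a b ha hb =>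
      rw [← add_zero (0 : l ⊗[k] A)]; nth_rw 2 [← ha]; rw [← hb]
      simp only [map_add, LinearMap.add_apply]; abel
    | tmul f v =>
      simp only [trilinearBaseChange_tmul]
      have e := h.identity x u z y v
      rw [show a * (b * c * f) * d = a * b * c * d * f by ring,
        show b * (a * c * d) * f = a * b * c * d * f by ring,
        show a * b * d * c * f = a * b * c * d * f by ring,
        show b * c * (d * f * a) = a * b * c * d * f by ring,
        ← TensorProduct.tmul_sub, ← TensorProduct.tmul_sub, ← TensorProduct.tmul_sub, e, sub_self,
        TensorProduct.tmul_zero]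

/-- Absence of torsion alone may be lost under tensoring; bijectivity of multiplication by `n` is
not. -/
theorem nsmul_injective_baseChange {n : ℕ} (hn : Function.Bijective fun a : A => n • a) :
    Function.Injective fun a : l ⊗[k] A => n • a := by
  let f : A ≃ₗ[k] A := LinearEquiv.ofBijective (n • LinearMap.id) hn
  have hf : ∀ a : l ⊗[k] A, TensorProduct.AlgebraTensorModule.congr (LinearEquiv.refl l l) f a
      = n • a := by
    intro a
    induction a using TensorProduct.induction_on with
    | zero => simp
    | add a b ha hb => rw [map_add, ha, hb, smul_add]
    | tmul a x =>
      change a ⊗ₜ (n • x) = _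
      exact TensorProduct.tmul_smul n a x
  intro a b hab
  simp only [← hf] at hab
  exact (TensorProduct.AlgebraTensorModule.congr (LinearEquiv.refl l l) f).injective hab

theorem eq_zero_of_three {L : Type*} [AddCommGroup L] (hL : Function.Injective fun a : L => 3 • a)
    (a : L) (ha : a + a + a = 0) : a = 0 := by
  apply hL
  simp only [smul_zero]
  rw [← ha]
  abel

theorem FiveLinear.isJordanPair (h : FiveLinear S S') (h' : FiveLinear S' S)
    (hA : Function.Bijective fun a : A => 3 • a) (hC : Function.Bijective fun a : C => 3 • a) :
    IsJordanPair.{t} (LinearMap.BilinMap.toQuadraticMap S)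
      (LinearMap.BilinMap.toQuadraticMap S') := by
  refine ⟨h.identities h' (eq_zero_of_three hA.1), h'.identities h (eq_zero_of_three hC.1), fun l _ _ => ?_⟩
  refine ⟨LinearMap.BilinMap.toQuadraticMap (trilinearBaseChange l S),
    LinearMap.BilinMap.toQuadraticMap (trilinearBaseChange l S'), ?_, ?_, ?_, ?_⟩
  · intro x y
    simp [trilinearBaseChange_tmul]
  · intro x y
    simp [trilinearBaseChange_tmul]
  · refine (h.baseChange l).identities (h'.baseChange l) ?_
    exact eq_zero_of_three (nsmul_injective_baseChange l hA)
  · refine (h'.baseChange l).identities (h.baseChange l) ?_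
    exact eq_zero_of_three (nsmul_injective_baseChange l hC)

end FiveLinear

end JordanPair

/-! ## Locality and the Jacobson radical -/

section JordanUnits

variable {A : Type*} {C : Type*} [AddCommGroup A] [AddCommGroup C]

namespace JordanUnits

/-- The Bergman operator as a linear map. -/
def berg (S : A →ₗ[ℤ] A →ₗ[ℤ] C →ₗ[ℤ] A) (S' : C →ₗ[ℤ] C →ₗ[ℤ] A →ₗ[ℤ] C) (x : A) (y : C) :
    A →ₗ[ℤ] A :=
  LinearMap.id - (2 : ℤ) • (S x).flip y + S x x ∘ₗ S' y y

variable {N : AddSubgroup A} {N' : AddSubgroup C} {hat : A → C} {hat' : C → A}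
  {S : A →ₗ[ℤ] A →ₗ[ℤ] C →ₗ[ℤ] A} {S' : C →ₗ[ℤ] C →ₗ[ℤ] A →ₗ[ℤ] C}

theorem berg_apply (x : A) (y : C) (z : A) :
    berg S S' x y z = z - (2 : ℤ) • S x z y + S x x (S' y y z) := rfl

theorem fiveLinear (h : JordanUnits N N' hat hat' S S') (h' : JordanUnits N' N hat' hat S' S) :
    JordanPair.FiveLinear S S' := ⟨h.symm, h.five_linear h'⟩

/-! ### The nonunits form an ideal. -/

theorem mem_of_two_mem (h : JordanUnits N N' hat hat' S S') {x : A} (hx : x + x ∈ N) : x ∈ N := by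
  by_contra hc
  exact h.uc.two x hc hx

/-- The differences for `n` and `-n` in `add_mem` sum to `2 • S n n y`. -/
theorem quad_mem (h : JordanUnits N N' hat hat' S S') {n : A} (hn : n ∈ N) (y : C) :
    S n n y ∈ N := by
  obtain ⟨e, he⟩ := h.uc.exists_unit
  have h1 := h.add_mem e n y he hn
  have h2 := h.add_mem e (-n) y he (neg_mem hn)
  have h3 := N.add_mem h1 h2
  apply h.mem_of_two_mem
  convert h3 using 1
  simp only [map_add, LinearMap.add_apply, map_neg, LinearMap.neg_apply]
  abel

theorem triple_mem (h : JordanUnits N N' hat hat' S S') {n : A} (hn : n ∈ N) (z : A) (y : C) :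
    S n z y ∈ N := by
  have key : ∀ e, e ∉ N → S n e y ∈ N := by
    intro e he
    have h1 := N.sub_mem (h.add_mem e n y he hn) (h.quad_mem hn y)
    apply h.mem_of_two_mem
    convert h1 using 1
    simp only [map_add, LinearMap.add_apply, h.symm e n]
    abel
  by_cases hz : z ∈ N
  · obtain ⟨e, he⟩ := h.uc.exists_unit
    have h1 := key _ (UnitComplement.add_mem_notMem he hz)
    rw [map_add, LinearMap.add_apply] at h1
    exact (N.add_mem_cancel_left (key e he)).1 h1
  · exact key z hz

/-- At a unit `x`, the inverse of `S x x` preserves units, so `S x x` preserves nonunits. -/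
theorem quad_mem_right (h : JordanUnits N N' hat hat' S S') (h' : JordanUnits N' N hat' hat S' S)
    (x : A) {n : C} (hn : n ∈ N') : S x x n ∈ N := by
  by_cases hx : x ∈ N
  · exact h.quad_mem hx n
  · by_contra hc
    have := h'.map_notMem (hat x) _ (h.hat_notMem x hx) hc
    rw [h.inv x n hx] at this
    exact this hn

theorem triple_mem_right (h : JordanUnits N N' hat hat' S S')
    (h' : JordanUnits N' N hat' hat S' S) (x z : A) {n : C} (hn : n ∈ N') : S x z n ∈ N := by
  have h1 := N.sub_mem (N.sub_mem (h.quad_mem_right h' (x + z) hn) (h.quad_mem_right h' x hn))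
    (h.quad_mem_right h' z hn)
  apply h.mem_of_two_mem
  convert h1 using 1
  simp only [map_add, LinearMap.add_apply, h.symm z x]
  abel

/-- The factorization B_{x,y} = Q_{b+x} Q_b⁻¹ (operators composed as functions) for y = `hat b`;
`hat_shift` identifies the cross term. -/
theorem berg_unit (h : JordanUnits N N' hat hat' S S') (h' : JordanUnits N' N hat' hat S' S)
    {b : A} (hb : b ∉ N) (x z : A) :
    berg S S' x (hat b) z = S (b + x) (b + x) (S' (hat b) (hat b) z) := by
  have e := h.hat_shift h' hb z x
  simp only [berg_apply, map_add, LinearMap.add_apply, h.inv_right h' hb, h.symm x b,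
    h.symm x z, e]
  module

theorem berg_unit_right (h : JordanUnits N N' hat hat' S S')
    (h' : JordanUnits N' N hat' hat S' S) {b : A} (hb : b ∉ N) (x : A) (s : C) :
    berg S' S (hat b) x s = S' (hat b) (hat b) (S (b + x) (b + x) s) := by
  have e : S' (hat b) (hat b) (S b x s) = - S' (hat b) s x := by
    have e1 := h'.hat_shift h (h.hat_notMem b hb) (S' (hat b) (hat b) x) s
    rw [h.hat_hat b hb, h.inv_right h' hb] at e1
    have e2 := h.jp1_units h' hb s (S' (hat b) (hat b) x)
    rw [h.inv_right h' hb] at e2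
    rw [e2, h.inv b _ hb, h'.symm, e1]
  simp only [berg_apply, map_add, LinearMap.add_apply, h.inv b _ hb, h.symm x b, e]
  module

/-- With both Bergman operators factored by `berg_unit` and `berg_unit_right`, only the fundamental
formula remains. -/
theorem berg_quad_unit (h : JordanUnits N N' hat hat' S S')
    (h' : JordanUnits N' N hat' hat S' S) (x z : A) {y : C} (hy : y ∉ N') (w : C) :
    S (berg S S' x y z) (berg S S' x y z) w = berg S S' x y (S z z (berg S' S y x w)) := by
  obtain ⟨b, hb, rfl⟩ : ∃ b, b ∉ N ∧ hat b = y :=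
    ⟨hat' y, h'.hat_notMem y hy, h'.hat_hat y hy⟩
  have f := h.fiveLinear h'
  have f' := h'.fiveLinear h
  rw [h.berg_unit h' hb, h.berg_unit h' hb, h.berg_unit_right h' hb, f.jp3 f' h.tf3,
    f'.jp3 f h'.tf3]

/-- For a nonunit `y`, replace it by the units `y + c • u` with `c = ±1, ±2`. Both sides are
polynomials of degree at most four in `c`, and the constant terms are compared by interpolation. -/
theorem berg_quad (h : JordanUnits N N' hat hat' S S')
    (h' : JordanUnits N' N hat' hat S' S) (x z : A) (y w : C) :
    S (berg S S' x y z) (berg S S' x y z) w = berg S S' x y (S z z (berg S' S y x w)) := by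
  by_cases hy : y ∉ N'
  · exact h.berg_quad_unit h' x z hy w
  rw [not_not] at hy
  obtain ⟨u, hu⟩ := h'.uc.exists_unit
  have f := h.fiveLinear h'
  have f' := h'.fiveLinear h
  let B₁ : A →ₗ[ℤ] A := -(2 : ℤ) • (S x).flip u + (2 : ℤ) • (S x x ∘ₗ S' y u)
  let B₂ : A →ₗ[ℤ] A := S x x ∘ₗ S' u u
  let D₁ : C →ₗ[ℤ] C := -(2 : ℤ) • (S' u).flip x + (2 : ℤ) • (S' y u ∘ₗ S x x)
  let D₂ : C →ₗ[ℤ] C := S' u u ∘ₗ S x x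
  have hB : ∀ (c : ℤ) (v : A),
      berg S S' x (y + c • u) v = berg S S' x y v + c • B₁ v + (c * c) • B₂ v := by
    intro c v
    simp only [berg_apply, B₁, B₂, map_add, LinearMap.add_apply, map_smul, LinearMap.smul_apply,
      LinearMap.flip_apply, LinearMap.comp_apply, h'.symm u y]
    module
  have hD : ∀ (c : ℤ) (v : C),
      berg S' S (y + c • u) x v = berg S' S y x v + c • D₁ v + (c * c) • D₂ v := by
    intro c v
    simp only [berg_apply, D₁, D₂, map_add, LinearMap.add_apply, map_smul, LinearMap.smul_apply,
      LinearMap.flip_apply, LinearMap.comp_apply, h'.symm u y]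
    module
  -- The coefficients of `c ^ 4` agree, so four values of `c` are enough.
  have h4 : S (B₂ z) (B₂ z) w = B₂ (S z z (D₂ w)) := by
    simp only [B₂, D₂, LinearMap.comp_apply, f.jp3 f' h.tf3, f'.jp3 f h'.tf3]
  have key : ∀ c : ℤ, y + c • u ∉ N' →
      S (berg S S' x y z + c • B₁ z + (c * c) • B₂ z) (berg S S' x y z + c • B₁ z + (c * c) • B₂ z) w
        = berg S S' x y (S z z (berg S' S y x w + c • D₁ w + (c * c) • D₂ w))
          + c • B₁ (S z z (berg S' S y x w + c • D₁ w + (c * c) • D₂ w))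
          + (c * c) • B₂ (S z z (berg S' S y x w + c • D₁ w + (c * c) • D₂ w)) := by
    intro c hc
    rw [← hB, ← hD, ← hB]
    exact h.berg_quad_unit h' x z hc w
  have hu1 : y + (1 : ℤ) • u ∉ N' := by
    rw [one_smul, add_comm]; exact UnitComplement.add_mem_notMem hu hy
  have hu2 : y + (-1 : ℤ) • u ∉ N' := by
    rw [neg_one_smul, add_comm]
    exact UnitComplement.add_mem_notMem (UnitComplement.neg_notMem hu) hy
  have hu3 : y + (2 : ℤ) • u ∉ N' := by
    rw [two_smul, add_comm]; exact UnitComplement.add_mem_notMem (h'.uc.two u hu) hy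
  have hu4 : y + (-2 : ℤ) • u ∉ N' := by
    rw [neg_smul, two_smul, add_comm]
    exact UnitComplement.add_mem_notMem (UnitComplement.neg_notMem (h'.uc.two u hu)) hy
  have k1 := key 1 hu1
  have k2 := key (-1) hu2
  have k3 := key 2 hu3
  have k4 := key (-2) hu4
  clear key hB hD
  have hs1 := h.symm (B₁ z) (berg S S' x y z)
  have hs2 := h.symm (B₂ z) (berg S S' x y z)
  have hs3 := h.symm (B₂ z) (B₁ z)
  generalize berg S S' x y = B₀ at *
  generalize berg S' S y x = D₀ at *
  clear_value B₁ B₂ D₁ D₂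
  simp only [map_add, LinearMap.add_apply, map_smul, LinearMap.smul_apply, hs1, hs2, hs3,
    h4] at k1 k2 k3 k4
  rw [← sub_eq_zero]
  apply h.tf2
  apply h.tf3
  -- For a cubic `f`, `4 (f 1 + f (-1)) - (f 2 + f (-2))` is six times the constant term.
  linear_combination (norm := module) (4 : ℤ) • (k1 + k2) - (k3 + k4)

/-! ### Bijectivity of Bergman operators, and the radical. -/

theorem berg_sub_mem_left (h : JordanUnits N N' hat hat' S S') {x : A} (hx : x ∈ N) (y : C)
    (z : A) : berg S S' x y z - z ∈ N := by
  have := N.sub_mem (h.quad_mem hx (S' y y z)) (N.zsmul_mem (h.triple_mem hx z y) 2)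
  convert this using 1
  rw [berg_apply]; abel

theorem berg_sub_mem_right (h : JordanUnits N N' hat hat' S S')
    (h' : JordanUnits N' N hat' hat S' S) (x : A) {y : C} (hy : y ∈ N') (z : A) :
    berg S S' x y z - z ∈ N := by
  have := N.sub_mem (h.quad_mem_right h' x (h'.quad_mem hy z))
    (N.zsmul_mem (h.triple_mem_right h' x z hy) 2)
  convert this using 1
  rw [berg_apply]; abel

/-- Both Bergman operators preserve units. In `berg_quad` at a unit `z` the left side is then
bijective in `w`, which makes the outer factor `berg S S' x y` surjective. In the opposite version
it is the innermost factor, hence injective. -/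
theorem berg_bijective_of_sub_mem (h : JordanUnits N N' hat hat' S S')
    (h' : JordanUnits N' N hat' hat S' S) {x : A} {y : C} (h1 : ∀ z, berg S S' x y z - z ∈ N)
    (h2 : ∀ w, berg S' S y x w - w ∈ N') : Function.Bijective (berg S S' x y) := by
  constructor
  · rw [injective_iff_map_eq_zero]
    intro v hv
    obtain ⟨w, hw⟩ := h'.uc.exists_unit
    have hY := UnitComplement.add_mem_notMem hw (h2 w)
    rw [add_sub_cancel] at hY
    have e := h'.berg_quad h y w x v
    rw [hv, map_zero, map_zero] at e
    have := h'.inv _ v hY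
    rwa [e, map_zero, eq_comm] at this
  · intro a
    obtain ⟨z, hz⟩ := h.uc.exists_unit
    have hX := UnitComplement.add_mem_notMem hz (h1 z)
    rw [add_sub_cancel] at hX
    have e := h.inv_right h' hX a
    rw [h.berg_quad h'] at e
    exact ⟨_, e⟩

theorem berg_bijective (h : JordanUnits N N' hat hat' S S')
    (h' : JordanUnits N' N hat' hat S' S) {x : A} {y : C} (hxy : x ∈ N ∨ y ∈ N') :
    Function.Bijective (berg S S' x y) := by
  rcases hxy with hx | hy
  · exact h.berg_bijective_of_sub_mem h' (h.berg_sub_mem_left hx y)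
      (h'.berg_sub_mem_right h y hx)
  · exact h.berg_bijective_of_sub_mem h' (h.berg_sub_mem_right h' x hy)
      (h'.berg_sub_mem_left hy x)

/-- `-hat x` is the Jordan inverse of `x`; this pair excludes units from the radical. -/
theorem berg_neg_hat (h : JordanUnits N N' hat hat' S S') (h' : JordanUnits N' N hat' hat S' S)
    {x : A} (hx : x ∉ N) (z : A) : berg S S' x (-hat x) z = 0 := by
  simp only [berg_apply, map_neg, LinearMap.neg_apply, h.hat_right x z hx, neg_neg,
    h.inv_right h' hx]
  module

theorem bergman_eq (h : JordanUnits N N' hat hat' S S') (x : A) (y : C) :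
    JordanPair.bergman (LinearMap.BilinMap.toQuadraticMap S)
      (LinearMap.BilinMap.toQuadraticMap S') x y = berg S S' x y := by
  ext z
  simp only [JordanPair.bergman, JordanPair.triple_toQuadraticMap h.symm, berg_apply,
    LinearMap.BilinMap.toQuadraticMap_apply]
  module

theorem not_bijective_zero (h : JordanUnits N N' hat hat' S S') {f : A → A} (hf : ∀ z, f z = 0) :
    ¬ Function.Bijective f := by
  intro hb
  obtain ⟨e, he⟩ := h.uc.exists_unit
  have := hb.1 ((hf e).trans (hf 0).symm)
  exact he (this ▸ N.zero_mem)

theorem radPlus_eq (h : JordanUnits N N' hat hat' S S') (h' : JordanUnits N' N hat' hat S' S) :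
    JordanPair.radPlus (LinearMap.BilinMap.toQuadraticMap S)
      (LinearMap.BilinMap.toQuadraticMap S') = N := by
  ext x
  simp only [JordanPair.radPlus, JordanPair.IsQuasiInvertible, h.bergman_eq, Set.mem_ofPred_eq,
    SetLike.mem_coe]
  refine ⟨fun hx => ?_, fun hx y => h.berg_bijective h' (Or.inl hx)⟩
  by_contra hc
  exact h.not_bijective_zero (h.berg_neg_hat h' hc) (hx _)

theorem radMinus_eq (h : JordanUnits N N' hat hat' S S') (h' : JordanUnits N' N hat' hat S' S) :
    JordanPair.radMinus (LinearMap.BilinMap.toQuadraticMap S)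
      (LinearMap.BilinMap.toQuadraticMap S') = N' := by
  ext y
  simp only [JordanPair.radMinus, JordanPair.IsQuasiInvertible, h.bergman_eq, Set.mem_ofPred_eq,
    SetLike.mem_coe]
  refine ⟨fun hy => ?_, fun hy x => h.berg_bijective h' (Or.inr hy)⟩
  by_contra hc
  have hy' := UnitComplement.neg_notMem (h'.hat_notMem y hc)
  refine h.not_bijective_zero (h.berg_neg_hat h' hy') ?_
  rw [h.hat_neg _ (h'.hat_notMem y hc), h'.hat_hat y hc, neg_neg]
  exact hy _

theorem isInvertible_iff (h : JordanUnits N N' hat hat' S S')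
    (h' : JordanUnits N' N hat' hat S' S) (x : A) :
    ¬ JordanPair.IsInvertible (LinearMap.BilinMap.toQuadraticMap S) x ↔ x ∈ N := by
  rw [not_iff_comm]
  refine ⟨fun hx => ⟨?_, fun a => ⟨_, h.inv_right h' hx a⟩⟩, fun hx hn => ?_⟩
  · exact Function.LeftInverse.injective (fun y => h.inv x y hx)
  · obtain ⟨e, he⟩ := h.uc.exists_unit
    obtain ⟨y, rfl⟩ := hx.2 e
    exact he (h.quad_mem hn y)

theorem idealConditions (h : JordanUnits N N' hat hat' S S')
    (h' : JordanUnits N' N hat' hat S' S) :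
    JordanPair.IdealConditions (LinearMap.BilinMap.toQuadraticMap S)
      (LinearMap.BilinMap.toQuadraticMap S') N.toIntSubmodule N'.toIntSubmodule := by
  intro x hx y z
  refine ⟨h'.quad_mem_right h y hx, h.quad_mem hx y, ?_⟩
  rw [JordanPair.triple_toQuadraticMap h.symm]
  exact N.add_mem (h.triple_mem hx z y) (h.triple_mem hx z y)

theorem isLocal (h : JordanUnits N N' hat hat' S S') (h' : JordanUnits N' N hat' hat S' S) :
    JordanPair.IsLocal (LinearMap.BilinMap.toQuadraticMap S)
      (LinearMap.BilinMap.toQuadraticMap S') := by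
  refine ⟨N.toIntSubmodule, N'.toIntSubmodule, fun x => (h.isInvertible_iff h' x).symm,
    fun y => (h'.isInvertible_iff h y).symm, ⟨h.idealConditions h', h'.idealConditions h⟩, ?_⟩
  rintro ⟨hI, -⟩
  obtain ⟨e, he⟩ := h.uc.exists_unit
  apply he
  have : e ∈ N.toIntSubmodule := by rw [hI]; trivial
  exact this

end JordanUnits

end JordanUnits

/-! ## From `μ`-maps to Jordan pairs -/

section MuUnits

variable {A : Type*} {C : Type*} [AddCommGroup A] [AddCommGroup C]

/-- The properties of the `μ`-maps `P x = μ_x : V^{-σ} → V^σ` of a special local Moufang set with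
abelian root groups, together with a biadditive map `T` that extends `μ_{x+z} - μ_x - μ_z`. The maps
`P'` are the `μ`-maps with respect to the opposite basis. -/
structure MuUnits (N : AddSubgroup A) (N' : AddSubgroup C) (hat : A → C) (hat' : C → A)
    (P : A → C → A) (P' : C → A → C) (T : A →ₗ[ℤ] A →ₗ[ℤ] C →ₗ[ℤ] A) : Prop where
  uc : UnitComplement N
  hat_notMem : ∀ x, x ∉ N → hat x ∉ N'
  hat_hat : ∀ x, x ∉ N → hat' (hat x) = x
  hat_neg : ∀ x, x ∉ N → hat (-x) = - hat x
  map_add : ∀ x y z, x ∉ N → P x (y + z) = P x y + P x z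
  inv : ∀ x y, x ∉ N → P' (hat x) (P x y) = y
  map_hat : ∀ x, x ∉ N → P x (hat x) = -x
  map_notMem : ∀ x y, x ∉ N → y ∉ N' → P x y ∉ N
  polar : ∀ x z y, x ∉ N → z ∉ N → x + z ∉ N → T x z y = P (x + z) y - P x y - P z y
  sum_hat : ∀ x b, x ∉ N → b ∉ N → x + b ∉ N → P (x + b) (hat x) = P b (hat x) - b - b - x
  hat_sum : ∀ a b z, a ∉ N → b ∉ N → a + b ∉ N →
    hat a + hat b ∉ N' ∧ P' (hat a + hat b) z = P' (hat b) (P (a + b) (P' (hat a) z))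
  comp : ∀ x y z, x ∉ N → y ∉ N' → P (P x y) z = P x (P' y (P (-x) z))
  add_mem : ∀ x n y, x ∉ N → n ∈ N → P (x + n) y - P x y ∈ N

namespace MuUnits

variable {N : AddSubgroup A} {N' : AddSubgroup C} {hat : A → C} {hat' : C → A}
  {P : A → C → A} {P' : C → A → C} {T : A →ₗ[ℤ] A →ₗ[ℤ] C →ₗ[ℤ] A}
  {T' : C →ₗ[ℤ] C →ₗ[ℤ] A →ₗ[ℤ] C}

/-! ### Divisibility by 2 and 3. -/

theorem map_zero (h : MuUnits N N' hat hat' P P' T) {x : A} (hx : x ∉ N) : P x 0 = 0 :=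
  (AddMonoidHom.mk' (P x) (fun y z => h.map_add x y z hx)).map_zero

theorem map_neg (h : MuUnits N N' hat hat' P P' T) {x : A} (hx : x ∉ N) (y : C) :
    P x (-y) = - P x y :=
  (AddMonoidHom.mk' (P x) (fun y z => h.map_add x y z hx)).map_neg y

theorem map_sub (h : MuUnits N N' hat hat' P P' T) {x : A} (hx : x ∉ N) (y z : C) :
    P x (y - z) = P x y - P x z :=
  (AddMonoidHom.mk' (P x) (fun y z => h.map_add x y z hx)).map_sub y z

theorem inv_right (h : MuUnits N N' hat hat' P P' T) (h' : MuUnits N' N hat' hat P' P T')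
    {x : A} (hx : x ∉ N) (z : A) : P x (P' (hat x) z) = z := by
  have := h'.inv (hat x) z (h.hat_notMem x hx)
  rwa [h.hat_hat x hx] at this

/-- Evenness of `P` is not yet available. The value comes from computing `T (2x) (-x)` both by
biadditivity and by `polar`. -/
theorem polar_self (h : MuUnits N N' hat hat' P P' T) {x : A} (hx : x ∉ N) (y : C) :
    T x x y = P x y + P (-x) y := by
  have h2 := h.uc.two x hx
  have hn := UnitComplement.neg_notMem hx
  have e1 := h.polar x x y hx hx h2
  have e2 := h.polar (x + x) (-x) y h2 hn (by simpa using hx)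
  simp only [add_neg_cancel_right, _root_.map_add, _root_.map_neg, LinearMap.add_apply,
    LinearMap.neg_apply] at e2
  linear_combination (norm := module) - e1 - e2

theorem map_two (h : MuUnits N N' hat hat' P P' T) {x : A} (hx : x ∉ N) (y : C) :
    P (x + x) y = 3 • P x y + P (-x) y := by
  have e1 := h.polar x x y hx hx (h.uc.two x hx)
  rw [h.polar_self hx] at e1
  linear_combination (norm := module) - e1

theorem map_three (h : MuUnits N N' hat hat' P P' T) {x : A} (hx : x ∉ N) (y : C) :
    P (x + x + x) y = 6 • P x y + 3 • P (-x) y := by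
  have e1 := h.polar (x + x) x y (h.uc.two x hx) hx (h.uc.three x hx)
  rw [_root_.map_add, LinearMap.add_apply, LinearMap.add_apply, h.polar_self hx,
    h.map_two hx] at e1
  linear_combination (norm := module) - e1

theorem map_four (h : MuUnits N N' hat hat' P P' T) {x : A} (hx : x ∉ N) (y : C) :
    P (x + x + (x + x)) y = 10 • P x y + 6 • P (-x) y := by
  rw [h.map_two (h.uc.two x hx), h.map_two hx, neg_add,
    h.map_two (UnitComplement.neg_notMem hx), neg_neg]
  module

theorem map_nsmul (h : MuUnits N N' hat hat' P P' T) {x : A} (hx : x ∉ N) (n : ℕ) (y : C) :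
    P x (n • y) = n • P x y :=
  (AddMonoidHom.mk' (P x) (fun y z => h.map_add x y z hx)).map_nsmul n y

/-- The bijection `P w` is `n` times an additive map, so its surjectivity makes `n` surjective. If
`n • a = 0`, then the preimage of `a` under `P x` is also killed by `n`, hence by `P w`, and so is
zero. -/
theorem nsmul_bijective (h : MuUnits N N' hat hat' P P' T) (h' : MuUnits N' N hat' hat P' P T')
    {x w : A} (hx : x ∉ N) (hw : w ∉ N) {n i j : ℕ}
    (e : ∀ y, P w y = (n * i) • P x y + (n * j) • P (-x) y) :
    Function.Bijective fun a : A => n • a := by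
  have hn := UnitComplement.neg_notMem hx
  constructor
  · refine (injective_iff_map_eq_zero (nsmulAddMonoidHom n : A →+ A)).2 fun a ha => ?_
    change n • a = 0 at ha
    rw [← h.inv_right h' hx a] at ha ⊢
    rw [← h.map_nsmul hx] at ha
    have e1 : n • P' (hat x) a = 0 := by
      rw [← h.inv x (n • P' (hat x) a) hx, ha, h'.map_zero (h.hat_notMem x hx)]
    have e2 := e (P' (hat x) a)
    rw [mul_comm, mul_smul, ← h.map_nsmul hx, mul_comm n j, mul_smul, ← h.map_nsmul hn, e1,
      h.map_zero hx, h.map_zero hn, smul_zero, smul_zero, add_zero] at e2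
    rw [← h.inv w (P' (hat x) a) hw, e2, h'.map_zero (h.hat_notMem w hw), h.map_zero hx]
  · intro a
    refine ⟨i • P x (P' (hat w) a) + j • P (-x) (P' (hat w) a), ?_⟩
    change n • _ = a
    rw [smul_add, ← mul_smul, ← mul_smul, ← e, h.inv_right h' hw]

theorem two_bijective (h : MuUnits N N' hat hat' P P' T) (h' : MuUnits N' N hat' hat P' P T') :
    Function.Bijective fun a : A => 2 • a := by
  obtain ⟨x, hx⟩ := h.uc.exists_unit
  -- The unit is `4x`, with coefficients 10 and 6; those of `2x` are 3 and 1, which are odd.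
  exact h.nsmul_bijective h' (i := 5) (j := 3) hx (h.uc.two _ (h.uc.two x hx)) (h.map_four hx)

theorem three_bijective (h : MuUnits N N' hat hat' P P' T) (h' : MuUnits N' N hat' hat P' P T') :
    Function.Bijective fun a : A => 3 • a := by
  obtain ⟨x, hx⟩ := h.uc.exists_unit
  exact h.nsmul_bijective h' (i := 2) (j := 1) hx (h.uc.three x hx) (h.map_three hx)

/-! ### Symmetry of `T` and evenness of `P`. -/

theorem tf2 (h : MuUnits N N' hat hat' P P' T) (h' : MuUnits N' N hat' hat P' P T') (a : A)
    (ha : a + a = 0) : a = 0 := by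
  apply (h.two_bijective h').1
  simpa [two_smul] using ha

theorem polar_symm (h : MuUnits N N' hat hat' P P' T) (h' : MuUnits N' N hat' hat P' P T')
    (x z : A) : T x z = T z x := by
  ext y
  rw [← sub_eq_zero]
  refine h.uc.eq_zero_of_biadditive (h.tf2 h') (fun x z => T x z y - T z x y) ?_ ?_ ?_ x z
  · intro a b c
    simp only [_root_.map_add, LinearMap.add_apply]; abel
  · intro a b c
    simp only [_root_.map_add, LinearMap.add_apply]; abel
  · intro x z hx hz hxz
    have hzx : z + x ∉ N := by rwa [add_comm]
    simp only [h.polar x z y hx hz hxz, h.polar z x y hz hx hzx, add_comm z x]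
    abel

theorem polar_hat (h : MuUnits N N' hat hat' P P' T) (h' : MuUnits N' N hat' hat P' P T')
    {x : A} (hx : x ∉ N) (z : A) : T x z (hat x) = - z - z := by
  have : T x z (hat x) + z + z = 0 := by
    refine h.uc.eq_zero_of_near (h.tf2 h') (fun z => T x z (hat x) + z + z) ?_ hx ?_ z
    · intro a b
      simp only [_root_.map_add, LinearMap.add_apply]; abel
    · intro z hz h1 _
      simp only [h.polar x z _ hx hz h1, h.sum_hat x z hx hz h1, h.map_hat x hx]
      abel
  linear_combination (norm := module) this

/-- In `hat_sum` at `z = P a y` the right-hand factor `P' (hat a)` cancels; this is the source of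
`k2`. -/
theorem polar_hat_hat (h : MuUnits N N' hat hat' P P' T) (h' : MuUnits N' N hat' hat P' P T')
    {a b : A} (ha : a ∉ N) (hb : b ∉ N) (hab : a + b ∉ N) (y : C) :
    T' (hat a) (hat b) (P a y) = P' (hat b) (T a b y) := by
  have hb' := h.hat_notMem b hb
  obtain ⟨hs, e⟩ := h.hat_sum a b (P a y) ha hb hab
  rw [h'.polar _ _ _ (h.hat_notMem a ha) hb' hs, e, h.polar a b y ha hb hab, h'.map_sub hb',
    h'.map_sub hb', h.inv a y ha, h.inv b y hb]
  abel

/-- Compare `polar_hat_hat` for `a, b` at `hat b` with that for `a, -b` at `-hat b`. The left sides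
agree, and by `polar_hat` the right sides are `P' (hat b)` and `P' (-hat b)` at `-2a`. -/
theorem map_neg_left (h : MuUnits N N' hat hat' P P' T) (h' : MuUnits N' N hat' hat P' P T')
    {b : A} (hb : b ∉ N) (y : C) : P (-b) y = P b y := by
  have hn := UnitComplement.neg_notMem hb
  have hb' := h.hat_notMem b hb
  have hn' := UnitComplement.neg_notMem hb'
  have key : ∀ a, P' (hat b) a - P' (-hat b) a = 0 := by
    refine h.uc.eq_zero_of_near (h'.tf2 h) _ ?_ hb ?_
    · intro a c
      rw [h'.map_add _ _ _ hb', h'.map_add _ _ _ hn']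
      abel
    · intro a ha h1 h2
      have e1 := h.polar_hat_hat h' ha hb (by rwa [add_comm]) (hat b)
      have e2 := h.polar_hat_hat h' ha hn
        (fun hc => h2 (by simpa [sub_eq_add_neg, add_comm] using N.neg_mem hc)) (-hat b)
      rw [h.hat_neg b hb, h.map_neg ha] at e2
      simp only [_root_.map_neg, LinearMap.neg_apply, neg_neg] at e2
      rw [h.polar_symm h', h.polar_hat h' hb] at e1 e2
      apply h'.tf2 h
      rw [e1, h'.map_sub hb', h'.map_sub hn', h'.map_neg hb', h'.map_neg hn'] at e2
      linear_combination (norm := module) - e2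
  have e := sub_eq_zero.1 (key (P b y))
  rw [h.inv b y hb, ← h.hat_neg b hb] at e
  nth_rewrite 1 [e]
  exact h.inv_right h' hn _

/-- Half of the map `T`. -/
noncomputable def halfPolar (T : A →ₗ[ℤ] A →ₗ[ℤ] C →ₗ[ℤ] A)
    (h2 : Function.Bijective fun a : A => 2 • a) : A →ₗ[ℤ] A →ₗ[ℤ] C →ₗ[ℤ] A :=
  T.compr₂ (LinearMap.compRight ℤ
    (LinearEquiv.ofBijective ((2 : ℕ) • LinearMap.id : A →ₗ[ℤ] A) h2).symm.toLinearMap)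

theorem two_halfPolar (T : A →ₗ[ℤ] A →ₗ[ℤ] C →ₗ[ℤ] A)
    (h2 : Function.Bijective fun a : A => 2 • a) (x z : A) (y : C) :
    2 • halfPolar T h2 x z y = T x z y :=
  (LinearEquiv.ofBijective ((2 : ℕ) • LinearMap.id : A →ₗ[ℤ] A) h2).apply_symm_apply (T x z y)

theorem quad_eq (h : MuUnits N N' hat hat' P P' T) (h' : MuUnits N' N hat' hat P' P T')
    {x : A} (hx : x ∉ N) (y : C) : halfPolar T (h.two_bijective h') x x y = P x y := by
  apply (h.two_bijective h').1
  change 2 • _ = 2 • _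
  rw [two_halfPolar, h.polar_self hx, h.map_neg_left h' hx, two_smul]

theorem jordanUnits (h : MuUnits N N' hat hat' P P' T) (h' : MuUnits N' N hat' hat P' P T') :
    JordanUnits N N' hat hat' (halfPolar T (h.two_bijective h'))
      (halfPolar T' (h'.two_bijective h)) where
  uc := h.uc
  tf2 := h.tf2 h'
  tf3 := JordanPair.eq_zero_of_three (h.three_bijective h').1
  hat_notMem := h.hat_notMem
  hat_hat := h.hat_hat
  hat_neg := h.hat_neg
  symm x z := by
    ext y
    apply (h.two_bijective h').1
    change 2 • _ = 2 • _
    rw [two_halfPolar, two_halfPolar, h.polar_symm h']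
  hat_right x z hx := by
    apply (h.two_bijective h').1
    change 2 • _ = 2 • _
    rw [two_halfPolar, h.polar_hat h' hx]
    module
  inv x y hx := by
    rw [h.quad_eq h' hx, h'.quad_eq h (h.hat_notMem x hx), h.inv x y hx]
  ff x y z hx hy := by
    rw [h.quad_eq h' hx, h.quad_eq h' (h.map_notMem x y hx hy), h.quad_eq h' hx,
      h'.quad_eq h hy, h.quad_eq h' hx, h.comp x y z hx hy, h.map_neg_left h' hx]
  map_notMem x y hx hy := by
    rw [h.quad_eq h' hx]
    exact h.map_notMem x y hx hy
  k2 a b y ha hb hab := by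
    apply (h'.two_bijective h).1
    change 2 • _ = 2 • _
    rw [two_halfPolar, h.quad_eq h' ha, ← _root_.map_nsmul, two_halfPolar,
      h'.quad_eq h (h.hat_notMem b hb), h.polar_hat_hat h' ha hb hab]
  add_mem x n y hx hn := by
    rw [h.quad_eq h' hx, h.quad_eq h' (UnitComplement.add_mem_notMem hx hn)]
    exact h.add_mem x n y hx hn

end MuUnits

end MuUnits

/-! ## The `μ`-maps of a special local Moufang set

For a unit `x`, the elements `B.alphaUnit x` and `B.swap.alphaUnit x` are `α_x` and `β_x`. -/

namespace LocalMoufangSet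

namespace Basis

variable {X : Type u} {M : LocalMoufangSet X}

theorem IsUnit.swap {B : M.Basis} {x : X} (hx : B.IsUnit x) : B.swap.IsUnit x := ⟨hx.2, hx.1⟩

section

variable (B : M.Basis) {x : X} (hx : B.IsUnit x)

theorem alphaUnit_mem : B.alphaUnit x hx ∈ M.U B.inf := B.alpha_mem _

theorem swap_alphaUnit_mem : B.swap.alphaUnit x hx.swap ∈ M.U B.zero := B.swap.alpha_mem _

theorem alphaUnit_zero : B.alphaUnit x hx • B.zero = x := B.alpha_smul _

theorem alphaUnit_inf : B.alphaUnit x hx • B.inf = B.inf := M.fixes _ _ (B.alphaUnit_mem hx)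

theorem swap_alphaUnit_inf : B.swap.alphaUnit x hx.swap • B.inf = x := B.swap.alpha_smul _

theorem swap_alphaUnit_zero : B.swap.alphaUnit x hx.swap • B.zero = B.zero :=
  M.fixes _ _ (B.swap_alphaUnit_mem hx)

theorem eq_alphaUnit {g : SymRel M.rel} (hg : g ∈ M.U B.inf) (h : g • B.zero = x) :
    g = B.alphaUnit x hx := B.alpha_unique _ g hg h

theorem isUnit_neg : B.IsUnit ((B.alphaUnit x hx)⁻¹ • B.zero) :=
  ⟨B.neg_not_rel ⟨x, hx.2⟩ hx.1, (B.neg ⟨x, hx.2⟩).2⟩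

theorem alphaUnit_neg :
    B.alphaUnit _ (B.isUnit_neg hx) = (B.alphaUnit x hx)⁻¹ :=
  (B.eq_alphaUnit _ (inv_mem (B.alphaUnit_mem hx)) rfl).symm

end

theorem alphaUnit_congr (B : M.Basis) {x y : X} (hx : B.IsUnit x) (hy : B.IsUnit y) (e : x = y) :
    B.alphaUnit x hx = B.alphaUnit y hy := by
  subst e
  rfl

theorem mu_congr (B : M.Basis) {x y : X} (hx : B.IsUnit x) (hy : B.IsUnit y) (e : x = y) :
    B.mu x hx = B.mu y hy := by
  subst e
  rfl

theorem alpha_conj (B B' : M.Basis) {g : SymRel M.rel}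
    (hg : g ∈ (⨆ y, M.U y : Subgroup (SymRel M.rel))) (h0 : g • B.zero = B'.zero)
    (hi : g • B.inf = B'.inf) (x : B.Aff) (x' : B'.Aff) (hx : g • x.1 = x'.1) :
    g * B.alpha x * g⁻¹ = B'.alpha x' := by
  apply B'.alpha_unique
  · rw [← hi, ← M.conj_eq B.inf g hg]
    exact ⟨B.alpha x, B.alpha_mem x, rfl⟩
  · rw [← h0, mul_smul, mul_smul, inv_smul_smul, B.alpha_smul, hx]

theorem mu_mem (B : M.Basis) (x : X) (hx : B.IsUnit x) :
    B.mu x hx ∈ (⨆ y, M.U y : Subgroup (SymRel M.rel)) := by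
  obtain ⟨g, hg, h, hh, e⟩ := (B.existsUnique_mu x hx).choose_spec.1.1
  change B.mu x hx = _ at e
  rw [e]
  exact mul_mem (mul_mem (Subgroup.mem_iSup_of_mem _ hh)
    (Subgroup.mem_iSup_of_mem _ (B.alphaUnit_mem hx))) (Subgroup.mem_iSup_of_mem _ hg)

theorem eq_mu (B : M.Basis) {x : X} (hx : B.IsUnit x) {m g h : SymRel M.rel}
    (hg : g ∈ M.U B.zero) (hh : h ∈ M.U B.zero) (e : m = h * B.alphaUnit x hx * g)
    (h0 : m • B.zero = B.inf) (hi : m • B.inf = B.zero) : m = B.mu x hx :=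
  (B.existsUnique_mu x hx).choose_spec.2 m ⟨⟨g, hg, h, hh, e⟩, h0, hi⟩

theorem mu_inv_zero (B : M.Basis) {x : X} (hx : B.IsUnit x) :
    (B.mu x hx)⁻¹ • B.zero = B.inf := by rw [inv_smul_eq_iff, B.mu_inf]

theorem mu_inv_inf (B : M.Basis) {x : X} (hx : B.IsUnit x) :
    (B.mu x hx)⁻¹ • B.inf = B.zero := by rw [inv_smul_eq_iff, B.mu_zero]

/-- The negatives of a unit in `V⁺` and in `V⁻` agree. -/
def NegSwap (B : M.Basis) : Prop :=
  ∀ (x : X) (hx : B.IsUnit x),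
    (B.swap.alphaUnit x hx.swap)⁻¹ • B.inf = (B.alphaUnit x hx)⁻¹ • B.zero

theorem NegSwap.swap {B : M.Basis} (h : B.NegSwap) : B.swap.NegSwap :=
  fun x hx => (h x ⟨hx.2, hx.1⟩).symm

/-- Conjugation by `τ` turns the `α` of `x τ⁻¹` into `β_x`, so `~x` is the negative of `x` in V⁻.
Unlike the definition, this form does not involve `τ` and is symmetric in the basis. -/
theorem IsSpecial.negSwap {B : M.Basis} {e : X} {he : B.IsUnit e} (h : B.IsSpecial e he) :
    B.NegSwap := by
  intro x hx
  have e1 : B.mu e he * B.alpha (B.muInvPlus e he ⟨x, hx.1⟩) * (B.mu e he)⁻¹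
      = B.swap.alphaUnit x hx.swap :=
    alpha_conj B B.swap (B.mu_mem e he) (B.mu_zero e he) (B.mu_inf e he)
      (B.muInvPlus e he ⟨x, hx.1⟩) ⟨x, hx.1⟩ (smul_inv_smul _ _)
  have e2 : B.mu e he • (B.alpha (B.muInvPlus e he ⟨x, hx.1⟩))⁻¹ • B.zero
      = (B.alphaUnit x hx)⁻¹ • B.zero := h x hx
  rw [← e1, ← e2, mul_inv_rev, mul_inv_rev, inv_inv, mul_smul, mul_smul, B.mu_inv_inf]

/-- The outer factors in U_0 must send `∞` to `-x` and `x` to `∞`; by `NegSwap` both are `β_x⁻¹`. -/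
theorem mu_eq {B : M.Basis} (h : B.NegSwap) {x : X} (hx : B.IsUnit x) :
    B.mu x hx
      = (B.swap.alphaUnit x hx.swap)⁻¹ * B.alphaUnit x hx * (B.swap.alphaUnit x hx.swap)⁻¹ := by
  symm
  have hb := inv_mem (B.swap_alphaUnit_mem hx)
  refine B.eq_mu hx hb hb rfl ?_ ?_
  · rw [mul_smul, mul_smul, M.fixes _ _ hb, B.alphaUnit_zero, inv_smul_eq_iff,
      B.swap_alphaUnit_inf hx]
  · rw [mul_smul, mul_smul, h x hx, smul_inv_smul, M.fixes _ _ hb]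

theorem mu_smul_self {B : M.Basis} (h : B.NegSwap) {x : X} (hx : B.IsUnit x) :
    B.mu x hx • x = (B.alphaUnit x hx)⁻¹ • B.zero := by
  have e1 : (B.swap.alphaUnit x hx.swap)⁻¹ • x = B.inf := by
    rw [inv_smul_eq_iff, B.swap_alphaUnit_inf hx]
  rw [mu_eq h, mul_smul, mul_smul, e1, B.alphaUnit_inf, h x hx]

theorem mu_conj_alpha (B : M.Basis) {x : X} (hx : B.IsUnit x) (z : B.Aff) :
    B.mu x hx * B.alpha z * (B.mu x hx)⁻¹ = B.swap.alpha (B.muMinus x hx z) :=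
  alpha_conj B B.swap (B.mu_mem x hx) (B.mu_zero x hx) (B.mu_inf x hx) _ _ rfl

theorem mu_conj_swap_alpha (B : M.Basis) {x : X} (hx : B.IsUnit x) (y : B.swap.Aff) :
    B.mu x hx * B.swap.alpha y * (B.mu x hx)⁻¹ = B.alpha (B.muPlus x hx y) :=
  alpha_conj B.swap B (B.mu_mem x hx) (B.mu_inf x hx) (B.mu_zero x hx) _ _ rfl

theorem isUnit_mu_smul (B : M.Basis) {x y : X} (hx : B.IsUnit x) (hy : B.IsUnit y) :
    B.IsUnit (B.mu x hx • y) :=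
  ⟨(B.muMinus x hx ⟨y, hy.2⟩).2, (B.muPlus x hx ⟨y, hy.1⟩).2⟩

theorem mu_conj_alphaUnit (B : M.Basis) {x y : X} (hx : B.IsUnit x) (hy : B.IsUnit y) :
    B.mu x hx * B.alphaUnit y hy * (B.mu x hx)⁻¹
      = B.swap.alphaUnit _ (B.isUnit_mu_smul hx hy).swap :=
  B.mu_conj_alpha hx _

theorem mu_conj_swap_alphaUnit (B : M.Basis) {x y : X} (hx : B.IsUnit x) (hy : B.IsUnit y) :
    B.mu x hx * B.swap.alphaUnit y hy.swap * (B.mu x hx)⁻¹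
      = B.alphaUnit _ (B.isUnit_mu_smul hx hy) :=
  B.mu_conj_swap_alpha hx _

/-- Conjugation by `μ_x` turns `β_x` into `α_{-x} = α_x⁻¹`; substitute this in `mu_eq`. -/
theorem mu_eq' {B : M.Basis} (h : B.NegSwap) {x : X} (hx : B.IsUnit x) :
    B.mu x hx = B.alphaUnit x hx * (B.swap.alphaUnit x hx.swap)⁻¹ * B.alphaUnit x hx := by
  have e1 := B.mu_conj_swap_alphaUnit hx hx
  rw [B.alphaUnit_congr _ (B.isUnit_neg hx) (mu_smul_self h hx), alphaUnit_neg,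
    mul_inv_eq_iff_eq_mul] at e1
  rw [mul_assoc, ← inv_mul_eq_iff_eq_mul, ← e1, mu_eq h]
  simp

theorem swap_mu {B : M.Basis} (h : B.NegSwap) {x : X} (hx : B.IsUnit x) :
    B.swap.mu x hx.swap = (B.mu x hx)⁻¹ := by
  have e : B.swap.mu x hx.swap
      = (B.alphaUnit x hx)⁻¹ * B.swap.alphaUnit x hx.swap * (B.alphaUnit x hx)⁻¹ :=
    mu_eq h.swap hx.swap
  rw [e, mu_eq' h]
  group

theorem swap_alphaUnit_neg {B : M.Basis} (h : B.NegSwap) {x : X} (hx : B.IsUnit x) :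
    B.swap.alphaUnit _ (B.isUnit_neg hx).swap = (B.swap.alphaUnit x hx.swap)⁻¹ :=
  (B.swap.eq_alphaUnit _ (inv_mem (B.swap_alphaUnit_mem hx)) (h x hx)).symm

theorem mu_neg {B : M.Basis} (h : B.NegSwap) {x : X} (hx : B.IsUnit x) :
    B.mu _ (B.isUnit_neg hx) = (B.mu x hx)⁻¹ := by
  rw [mu_eq h, mu_eq h, swap_alphaUnit_neg h, alphaUnit_neg]
  group

/-- Conjugation by `μ_x` exchanges `α_y` and `β_y` with those of the image point, reversing the
roles in the palindrome; hence the inverse. -/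
theorem mu_mu_smul {B : M.Basis} (h : B.NegSwap) {x y : X} (hx : B.IsUnit x) (hy : B.IsUnit y) :
    B.mu _ (B.isUnit_mu_smul hx hy) = B.mu x hx * (B.mu y hy)⁻¹ * (B.mu x hx)⁻¹ := by
  rw [mu_eq' h (B.isUnit_mu_smul hx hy), ← B.mu_conj_alphaUnit hx hy,
    ← B.mu_conj_swap_alphaUnit hx hy, mu_eq h hy]
  group

/-- The point `x ⊕ z` of `V⁻` is a unit if the point `x + z` of `V⁺` is. -/
theorem isUnit_swap_sum {B : M.Basis} (h : B.NegSwap) {x z : X} (hx : B.IsUnit x)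
    (hz : B.IsUnit z) (hs : B.IsUnit (B.alphaUnit z hz • x)) :
    B.IsUnit (B.swap.alphaUnit z hz.swap • x) := by
  constructor
  · intro hr
    rw [← B.swap_alphaUnit_zero hz, SymRel.rel_smul] at hr
    exact hx.1 hr
  · intro hr
    apply hs.1
    rw [← SymRel.rel_smul (B.swap.alphaUnit z hz.swap)⁻¹, inv_smul_smul, h z hz,
      ← SymRel.rel_smul (B.alphaUnit z hz), smul_inv_smul] at hr
    exact hr

/-- The right side exchanges `0` and `∞`, so by uniqueness it need only lie in `U_∞ β U_∞` for the
`β` of the sum in V⁻. -/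
theorem mu_swap_sum {B : M.Basis} (h : B.NegSwap) {x z : X} (hx : B.IsUnit x)
    (hz : B.IsUnit z) (hs : B.IsUnit (B.alphaUnit z hz • x)) :
    (B.mu _ (isUnit_swap_sum h hx hz hs))⁻¹
      = (B.mu z hz)⁻¹ * B.mu _ hs * (B.mu x hx)⁻¹ := by
  rw [← swap_mu h (isUnit_swap_sum h hx hz hs)]
  symm
  have ea : B.alphaUnit _ hs = B.alphaUnit z hz * B.alphaUnit x hx :=
    (B.eq_alphaUnit hs (mul_mem (B.alphaUnit_mem hz) (B.alphaUnit_mem hx))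
      (by rw [mul_smul, B.alphaUnit_zero])).symm
  have eb : B.swap.alphaUnit _ (isUnit_swap_sum h hx hz hs).swap
      = B.swap.alphaUnit z hz.swap * B.swap.alphaUnit x hx.swap :=
    (B.swap.eq_alphaUnit _ (mul_mem (B.swap_alphaUnit_mem hz) (B.swap_alphaUnit_mem hx))
      (by rw [mul_smul]; exact congrArg _ (B.swap_alphaUnit_inf hx))).symm
  have e1 : B.swap.alphaUnit x hx.swap
      = B.alphaUnit x hx * (B.mu x hx)⁻¹ * B.alphaUnit x hx := by rw [mu_eq' h]; group
  have e2 : B.swap.alphaUnit z hz.swap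
      = B.alphaUnit z hz * (B.mu z hz)⁻¹ * B.alphaUnit z hz := by rw [mu_eq' h]; group
  have e3 : B.alphaUnit _ hs
      = B.swap.alphaUnit _ hs.swap * B.mu _ hs * B.swap.alphaUnit _ hs.swap := by
    rw [mu_eq h hs]; group
  have m1 : B.mu x hx * B.swap.alphaUnit _ hs.swap * (B.mu x hx)⁻¹ ∈ M.U B.inf := by
    rw [B.mu_conj_swap_alphaUnit hx hs]
    exact B.alphaUnit_mem _
  have m2 : (B.mu z hz)⁻¹ * B.swap.alphaUnit _ hs.swap * B.mu z hz ∈ M.U B.inf := by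
    have : B.mu _ (B.isUnit_neg hz) * B.swap.alphaUnit _ hs.swap * (B.mu _ (B.isUnit_neg hz))⁻¹
        ∈ M.U B.inf := by
      rw [B.mu_conj_swap_alphaUnit (B.isUnit_neg hz) hs]
      exact B.alphaUnit_mem _
    rwa [mu_neg h, inv_inv] at this
  refine B.swap.eq_mu (isUnit_swap_sum h hx hz hs).swap
    (g := (B.alphaUnit x hx)⁻¹ * (B.mu x hx * B.swap.alphaUnit _ hs.swap * (B.mu x hx)⁻¹)⁻¹)
    (h := ((B.mu z hz)⁻¹ * B.swap.alphaUnit _ hs.swap * B.mu z hz)⁻¹ * (B.alphaUnit z hz)⁻¹)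
    (mul_mem (inv_mem (B.alphaUnit_mem hx)) (inv_mem m1))
    (mul_mem (inv_mem m2) (inv_mem (B.alphaUnit_mem hz))) ?_ ?_ ?_
  -- Expand both `β` factors and merge `α_z α_x` into `α_s`. Writing `α_s = β_s μ_s β_s` and moving
  -- each `β_s` past a μ-map puts it in U_∞.
  · have e4 : B.swap.alphaUnit z hz.swap * B.swap.alphaUnit x hx.swap
        = B.alphaUnit z hz * (B.mu z hz)⁻¹ * B.alphaUnit _ hs * (B.mu x hx)⁻¹
          * B.alphaUnit x hx := by
      rw [ea, e1, e2]; group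
    rw [eb, e4, e3]
    group
  · change _ • B.inf = B.zero
    rw [mul_smul, mul_smul, B.mu_inv_inf, B.mu_zero, B.mu_inv_inf]
  · change _ • B.zero = B.inf
    rw [mul_smul, mul_smul, B.mu_inv_zero, B.mu_inf, B.mu_inv_zero]

/-- The two expressions `μ_z(x) - z` and `(x + z) + μ_{x + z}(x)` for the point `(x + z) ⊖ z`. -/
theorem mu_sum_smul {B : M.Basis} (h : B.NegSwap) (hB : B.IsAbelian) {x z : X} (hx : B.IsUnit x)
    (hz : B.IsUnit z) (hs : B.IsUnit (B.alphaUnit z hz • x)) :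
    (B.alphaUnit z hz)⁻¹ • B.mu z hz • x = B.alphaUnit _ hs • B.mu _ hs • x := by
  set s := B.alphaUnit z hz • x with hsdef
  set p := (B.swap.alphaUnit z hz.swap)⁻¹ • s with hp
  have ez : (B.swap.alphaUnit z hz.swap)⁻¹
      = (B.alphaUnit z hz)⁻¹ * B.mu z hz * (B.alphaUnit z hz)⁻¹ := by rw [mu_eq' h]; group
  have es : (B.swap.alphaUnit s hs.swap)⁻¹
      = (B.alphaUnit s hs)⁻¹ * B.mu s hs * (B.alphaUnit s hs)⁻¹ := by rw [mu_eq' h]; group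
  have ea : B.alphaUnit s hs = B.alphaUnit z hz * B.alphaUnit x hx :=
    (B.eq_alphaUnit hs (mul_mem (B.alphaUnit_mem hz) (B.alphaUnit_mem hx))
      (by rw [mul_smul, B.alphaUnit_zero])).symm
  have ep : p = (B.alphaUnit z hz)⁻¹ • B.mu z hz • x := by
    rw [hp, ez, mul_smul, mul_smul, hsdef, inv_smul_smul]
  have hpu : B.IsUnit p := by
    constructor
    · intro hr
      apply hs.1
      rw [← SymRel.rel_smul (B.swap.alphaUnit z hz.swap), hp, smul_inv_smul,
        B.swap_alphaUnit_zero hz] at hr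
      exact hr
    · intro hr
      apply hx.1
      rw [← SymRel.rel_smul (B.swap.alphaUnit z hz.swap), hp, smul_inv_smul,
        B.swap_alphaUnit_inf hz, ← B.alphaUnit_zero hz, hsdef, SymRel.rel_smul] at hr
      exact hr
  have eb : B.swap.alphaUnit p hpu.swap
      = (B.swap.alphaUnit z hz.swap)⁻¹ * B.swap.alphaUnit s hs.swap :=
    (B.swap.eq_alphaUnit _ (mul_mem (inv_mem (B.swap_alphaUnit_mem hz))
      (B.swap_alphaUnit_mem hs))
      (by rw [mul_smul]; exact congrArg _ (B.swap_alphaUnit_inf hs))).symm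
  have hm : B.mu s hs * B.swap.alphaUnit x hx.swap * (B.mu s hs)⁻¹ ∈ M.U B.inf := by
    rw [B.mu_conj_swap_alphaUnit hs hx]
    exact B.alphaUnit_mem _
  -- Both sides lie in U_∞, and they send `0` to the same point: `-p` is computed in V⁻ and read in
  -- V⁺ through `NegSwap`.
  have e1 : (B.alphaUnit s hs)⁻¹ * (B.mu s hs * B.swap.alphaUnit x hx.swap * (B.mu s hs)⁻¹)⁻¹
      = B.alphaUnit _ (B.isUnit_neg hpu) := by
    apply B.eq_alphaUnit _ (mul_mem (inv_mem (B.alphaUnit_mem hs)) (inv_mem hm))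
    have e2 : (B.alphaUnit s hs)⁻¹ • z = (B.alphaUnit x hx)⁻¹ • B.zero := by
      rw [ea, mul_inv_rev, mul_smul]
      congr 1
      rw [inv_smul_eq_iff, B.alphaUnit_zero]
    have e3 : (B.swap.alphaUnit p hpu.swap)⁻¹ • B.inf
        = (B.alphaUnit s hs)⁻¹ • B.mu s hs • (B.swap.alphaUnit x hx.swap)⁻¹ • B.inf := by
      rw [eb, mul_inv_rev, inv_inv, mul_smul, B.swap_alphaUnit_inf hz, es, mul_smul, mul_smul, e2,
        ← h x hx]
    rw [← h p hpu, e3]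
    simp only [mul_inv_rev, inv_inv, mul_smul, B.mu_inv_zero]
  rw [alphaUnit_neg, ← inv_inj, inv_inv, mul_inv_rev, inv_inv, inv_inv,
    hB _ hm _ (B.alphaUnit_mem hs)] at e1
  rw [← ep, ← B.alphaUnit_zero hpu, ← e1]
  simp only [mul_smul, B.mu_inv_zero, B.swap_alphaUnit_inf hx]
  rfl

/-- An element of `U_∞` that keeps `0` in its class fixes all classes. -/
theorem rel_smul_of_rel (B : M.Basis) {g : SymRel M.rel} (hg : g ∈ M.U B.inf)
    (h0 : M.rel (g • B.zero) B.zero) (x : X) : M.rel (g • x) x := by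
  have hne : Quotient.mk M.rel B.zero ≠ Quotient.mk M.rel B.inf :=
    fun h => B.not_rel (Quotient.exact h)
  have hu := (M.induced_sharplyTransitive B.inf _ _ hne hne).unique
    (y₁ := SymRel.induced M.rel g) (y₂ := 1) ⟨⟨g, hg, rfl⟩, Quotient.sound h0⟩
    ⟨one_mem _, one_smul _ _⟩
  have := congrArg (fun f : Equiv.Perm (Quotient M.rel) => f (Quotient.mk M.rel x)) hu
  exact Quotient.exact this

/-! ### The action of `μ_x` on classes depends only on the class of `x`. -/

theorem alphaUnit_smul_rel (B : M.Basis) {x z : X} (hx : B.IsUnit x) (hz : B.IsUnit z)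
    (h : M.rel x z) (y : X) : M.rel (B.alphaUnit x hx • y) (B.alphaUnit z hz • y) := by
  have h1 := B.rel_smul_of_rel (g := (B.alphaUnit z hz)⁻¹ * B.alphaUnit x hx)
    (mul_mem (inv_mem (B.alphaUnit_mem hz)) (B.alphaUnit_mem hx)) (by
      rw [← SymRel.rel_smul (B.alphaUnit z hz), ← mul_smul, mul_inv_cancel_left, B.alphaUnit_zero,
        B.alphaUnit_zero]
      exact h) y
  rw [← SymRel.rel_smul (B.alphaUnit z hz), ← mul_smul, mul_inv_cancel_left] at h1
  exact h1

theorem alphaUnit_inv_smul_rel (B : M.Basis) {x z : X} (hx : B.IsUnit x) (hz : B.IsUnit z)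
    (h : M.rel x z) (y : X) : M.rel ((B.alphaUnit x hx)⁻¹ • y) ((B.alphaUnit z hz)⁻¹ • y) := by
  have := B.alphaUnit_smul_rel hx hz h ((B.alphaUnit x hx)⁻¹ • y)
  rw [smul_inv_smul] at this
  have h2 := (SymRel.rel_smul (B.alphaUnit z hz)⁻¹ _ _).2 this
  rw [inv_smul_smul] at h2
  exact M.rel.symm h2

theorem mu_smul_rel {B : M.Basis} (h : B.NegSwap) {x z : X} (hx : B.IsUnit x) (hz : B.IsUnit z)
    (hxz : M.rel x z) (y : X) : M.rel (B.mu x hx • y) (B.mu z hz • y) := by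
  rw [mu_eq h, mu_eq h]
  simp only [mul_smul]
  have h1 := B.swap.alphaUnit_inv_smul_rel hx.swap hz.swap hxz y
  have h2 := (SymRel.rel_smul (B.alphaUnit x hx) _ _).2 h1
  have h3 := M.rel.trans h2 (B.alphaUnit_smul_rel hx hz hxz _)
  have h4 := (SymRel.rel_smul (B.swap.alphaUnit x hx.swap)⁻¹ _ _).2 h3
  exact M.rel.trans h4 (B.swap.alphaUnit_inv_smul_rel hx.swap hz.swap hxz _)

end Basis

end LocalMoufangSet

/-! ## The `ℤ`-modules `V⁺` and `V⁻` -/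

namespace LocalMoufangSet

namespace Basis

variable {X : Type u} {M : LocalMoufangSet X} {B : M.Basis} {hB : B.IsAbelian}

/-- The element `α_x` for `x` in `V⁺`. -/
noncomputable def V.alpha (x : B.V hB) : SymRel M.rel := Basis.alpha B x

namespace V

theorem ext {x z : B.V hB} (h : x.pt = z.pt) : x = z := Subtype.ext h

theorem not_rel_inf (x : B.V hB) : ¬ M.rel x.pt B.inf := Subtype.property x

theorem alpha_mem (x : B.V hB) : x.alpha ∈ M.U B.inf := Basis.alpha_mem B x

theorem alpha_zero_smul (x : B.V hB) : x.alpha • B.zero = x.pt := Basis.alpha_smul B x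

theorem alpha_add (x z : B.V hB) : (x + z).alpha = z.alpha * x.alpha :=
  Basis.alpha_orbitPt B _ (mul_mem z.alpha_mem x.alpha_mem)

theorem alpha_neg (x : B.V hB) : (-x).alpha = x.alpha⁻¹ :=
  Basis.alpha_orbitPt B _ (inv_mem x.alpha_mem)

theorem alpha_injective {x z : B.V hB} (h : x.alpha = z.alpha) : x = z :=
  Basis.alpha_injective B h

theorem pt_zero : (0 : B.V hB).pt = B.zero := one_smul _ _

theorem pt_add (x z : B.V hB) : (x + z).pt = z.alpha • x.pt := by
  rw [← alpha_zero_smul, alpha_add, mul_smul, alpha_zero_smul]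

theorem pt_neg (x : B.V hB) : (-x).pt = x.alpha⁻¹ • B.zero := by
  rw [← alpha_zero_smul, alpha_neg]

end V

variable (B hB) in
/-- The subgroup `[0]` of `V⁺`. -/
def nonunits : AddSubgroup (B.V hB) where
  carrier := {x | M.rel x.pt B.zero}
  zero_mem' := by
    change M.rel (0 : B.V hB).pt B.zero
    rw [V.pt_zero]
  add_mem' := by
    intro x z hx hz
    change M.rel (x + z).pt B.zero
    rw [V.pt_add]
    refine M.rel.trans ((SymRel.rel_smul z.alpha _ _).2 hx) ?_
    rw [V.alpha_zero_smul]
    exact hz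
  neg_mem' := by
    intro x hx
    change M.rel (-x).pt B.zero
    rw [V.pt_neg, ← SymRel.rel_smul x.alpha, smul_inv_smul, V.alpha_zero_smul]
    exact M.rel.symm hx

theorem mem_nonunits {x : B.V hB} : x ∈ B.nonunits hB ↔ M.rel x.pt B.zero := Iff.rfl

theorem isUnit_of_notMem {x : B.V hB} (hx : x ∉ B.nonunits hB) : B.IsUnit x.pt :=
  ⟨hx, x.not_rel_inf⟩

theorem V.alphaUnit_eq {x : B.V hB} (hx : B.IsUnit x.pt) : B.alphaUnit x.pt hx = x.alpha := rfl

theorem rel_of_sub_mem {x z : B.V hB} : x - z ∈ B.nonunits hB ↔ M.rel x.pt z.pt := by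
  rw [mem_nonunits, ← SymRel.rel_smul z.alpha, V.alpha_zero_smul, ← V.pt_add, sub_add_cancel]

open Classical in
variable (B hB) in
/-- A unit of `V⁺`, viewed as an element of `V⁻`. -/
noncomputable def hat (x : B.V hB) : B.swap.V hB.swap :=
  if hx : M.rel x.pt B.zero then 0 else ⟨x.pt, hx⟩

open Classical in
variable (B hB) in
/-- The map `μ_x : V⁻ → V⁺` for a unit `x` of `V⁺`. -/
noncomputable def muMap (x : B.V hB) (y : B.swap.V hB.swap) : B.V hB :=
  if hx : M.rel x.pt B.zero then 0 else B.muPlus x.pt ⟨hx, x.not_rel_inf⟩ y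

theorem pt_hat {x : B.V hB} (hx : x ∉ B.nonunits hB) : (B.hat hB x).pt = x.pt :=
  congrArg V.pt (dif_neg hx)

theorem muMap_eq {x : B.V hB} (hx : B.IsUnit x.pt) (y : B.swap.V hB.swap) :
    B.muMap hB x y = B.muPlus x.pt hx y :=
  dif_neg hx.1

theorem pt_muMap {x : B.V hB} (hx : B.IsUnit x.pt) (y : B.swap.V hB.swap) :
    (B.muMap hB x y).pt = B.mu x.pt hx • y.pt := by
  rw [muMap_eq hx]
  rfl

theorem alpha_muMap {x : B.V hB} (hx : B.IsUnit x.pt) (y : B.swap.V hB.swap) :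
    (B.muMap hB x y).alpha = B.mu x.pt hx * y.alpha * (B.mu x.pt hx)⁻¹ := by
  rw [muMap_eq hx]
  exact (B.mu_conj_swap_alpha hx y).symm

theorem muMap_add {x : B.V hB} (hx : B.IsUnit x.pt) (y z : B.swap.V hB.swap) :
    B.muMap hB x (y + z) = B.muMap hB x y + B.muMap hB x z := by
  apply V.alpha_injective
  rw [alpha_muMap hx, V.alpha_add, V.alpha_add, alpha_muMap hx, alpha_muMap hx]
  group

theorem muMap_mem {x : B.V hB} (hx : B.IsUnit x.pt) (y : B.swap.V hB.swap) :
    B.muMap hB x y ∈ B.nonunits hB ↔ y ∈ B.swap.nonunits hB.swap := by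
  rw [mem_nonunits, mem_nonunits, pt_muMap hx, ← B.mu_inf x.pt hx, SymRel.rel_smul]
  rfl

theorem unitComplement (h23 : ∀ (x : X) (hx : B.IsUnit x),
    B.IsUnit (B.times ⟨x, hx.2⟩ 2).1 ∧ B.IsUnit (B.times ⟨x, hx.2⟩ 3).1) :
    UnitComplement (B.nonunits hB) where
  exists_unit := by
    obtain ⟨c, hc⟩ := B.exists_unit
    exact ⟨⟨c, hc.2⟩, hc.1⟩
  two x hx := by
    have h := (h23 x.pt (isUnit_of_notMem hx)).1.1
    have e : (x + x).pt = x.alpha ^ 2 • B.zero := by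
      rw [← V.alpha_zero_smul, V.alpha_add, ← pow_two]
    rw [mem_nonunits, e]
    exact h
  three x hx := by
    have h := (h23 x.pt (isUnit_of_notMem hx)).2.1
    have e : (x + x + x).pt = x.alpha ^ 3 • B.zero := by
      rw [← V.alpha_zero_smul, V.alpha_add, V.alpha_add, ← pow_two, ← pow_succ']
    rw [mem_nonunits, e]
    exact h

/-- Condition (J3) concerns V⁺ only; it is transported by the μ-map of one unit, which is additive
and respects units. -/
theorem unitComplement_swap (h : UnitComplement (B.nonunits hB)) :
    UnitComplement (B.swap.nonunits hB.swap) := by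
  obtain ⟨c, hc⟩ := B.exists_unit
  let e : B.V hB := ⟨c, hc.2⟩
  have he : B.IsUnit e.pt := hc
  refine ⟨⟨⟨c, hc.1⟩, hc.2⟩, fun y hy => ?_, fun y hy => ?_⟩
  · rw [← muMap_mem he, muMap_add he]
    exact h.two _ (by rwa [muMap_mem he])
  · rw [← muMap_mem he, muMap_add he, muMap_add he]
    exact h.three _ (by rwa [muMap_mem he])

theorem hat_notMem {x : B.V hB} (hx : x ∉ B.nonunits hB) :
    B.hat hB x ∉ B.swap.nonunits hB.swap := by
  rw [mem_nonunits, pt_hat hx]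
  exact x.not_rel_inf

theorem isUnit_of_swap_notMem {y : B.swap.V hB.swap} (hy : y ∉ B.swap.nonunits hB.swap) :
    B.IsUnit y.pt := ⟨y.not_rel_inf, hy⟩

theorem alpha_hat {x : B.V hB} (hx : x ∉ B.nonunits hB) :
    (B.hat hB x).alpha = B.swap.alphaUnit x.pt (isUnit_of_notMem hx).swap :=
  B.swap.eq_alphaUnit _ (B.hat hB x).alpha_mem ((B.hat hB x).alpha_zero_smul.trans (pt_hat hx))

theorem pt_swap_muMap (h : B.NegSwap) {y : B.swap.V hB.swap} (hy : B.IsUnit y.pt) (z : B.V hB) :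
    V.pt (B.swap.muMap hB.swap y z) = (B.mu y.pt hy)⁻¹ • z.pt := by
  rw [← swap_mu h hy]
  exact pt_muMap hy.swap z

theorem pt_sub (x z : B.V hB) : (x - z).pt = z.alpha⁻¹ • x.pt := by
  rw [sub_eq_add_neg, V.pt_add, V.alpha_neg]

theorem pt_hat_add {a b : B.V hB} (ha : a ∉ B.nonunits hB) (hb : b ∉ B.nonunits hB) :
    (B.hat hB a + B.hat hB b).pt
      = B.swap.alphaUnit b.pt (isUnit_of_notMem hb).swap • a.pt := by
  rw [V.pt_add, alpha_hat hb, pt_hat ha]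

theorem muUnits (h : B.NegSwap) (huc : UnitComplement (B.nonunits hB))
    (T : B.VPlus hB →ₗ[ℤ] B.VPlus hB →ₗ[ℤ] B.VMinus hB →ₗ[ℤ] B.VPlus hB)
    (hT : B.ExtendsMuPlus hB T) :
    MuUnits (B.nonunits hB) (B.swap.nonunits hB.swap) (B.hat hB) (B.swap.hat hB.swap)
      (B.muMap hB) (B.swap.muMap hB.swap) T where
  uc := huc
  hat_notMem x hx := hat_notMem hx
  hat_hat x hx := V.ext ((pt_hat (hat_notMem hx)).trans (pt_hat hx))
  hat_neg x hx := by
    apply V.ext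
    have hx' := isUnit_of_notMem hx
    rw [pt_hat (UnitComplement.neg_notMem hx), V.pt_neg, V.pt_neg, alpha_hat hx]
    exact (h x.pt hx').symm
  map_add x y z hx := muMap_add (isUnit_of_notMem hx) y z
  inv x y hx := by
    apply V.ext
    have hx' := isUnit_of_notMem hx
    have hu : B.IsUnit (B.hat hB x).pt := isUnit_of_swap_notMem (hB := hB) (hat_notMem hx)
    rw [pt_swap_muMap h hu, pt_muMap hx', B.mu_congr hu hx' (pt_hat hx), inv_smul_smul]
  map_hat x hx := by
    apply V.ext
    have hx' := isUnit_of_notMem hx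
    rw [pt_muMap hx', pt_hat hx, mu_smul_self h hx', V.pt_neg]
    rfl
  map_notMem x y hx hy := by
    rwa [muMap_mem (isUnit_of_notMem hx)]
  polar x z y hx hz hxz := by
    rw [hT x z (isUnit_of_notMem hx) (isUnit_of_notMem hz) (isUnit_of_notMem hxz),
      muMap_eq (isUnit_of_notMem hx), muMap_eq (isUnit_of_notMem hz),
      muMap_eq (isUnit_of_notMem hxz)]
  sum_hat x b hx hb hxb := by
    have hx' := isUnit_of_notMem hx
    have hb' := isUnit_of_notMem hb
    have hs' := isUnit_of_notMem hxb
    have hs : B.IsUnit (B.alphaUnit b.pt hb' • x.pt) := by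
      rw [V.alphaUnit_eq, ← V.pt_add]
      exact hs'
    have e := mu_sum_smul h hB hx' hb' hs
    have e1 : B.muMap hB b (B.hat hB x) - b = B.muMap hB (x + b) (B.hat hB x) + (x + b) := by
      apply V.ext
      rw [pt_sub, V.pt_add, pt_muMap hb', pt_muMap hs', pt_hat hx]
      rw [B.alphaUnit_congr hs hs' (V.pt_add x b).symm,
        B.mu_congr hs hs' (V.pt_add x b).symm] at e
      exact e
    rw [sub_eq_iff_eq_add] at e1
    rw [e1]
    abel
  hat_sum a b z ha hb hab := by
    have ha' := isUnit_of_notMem ha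
    have hb' := isUnit_of_notMem hb
    have hs' := isUnit_of_notMem hab
    have hs : B.IsUnit (B.alphaUnit b.pt hb' • a.pt) := by
      rw [V.alphaUnit_eq, ← V.pt_add]
      exact hs'
    have hc : B.IsUnit (B.hat hB a + B.hat hB b).pt := by
      rw [pt_hat_add ha hb]
      exact isUnit_swap_sum h ha' hb' hs
    refine ⟨hc.2, ?_⟩
    apply V.ext
    have hau : B.IsUnit (B.hat hB a).pt := isUnit_of_swap_notMem (hB := hB) (hat_notMem ha)
    have hbu : B.IsUnit (B.hat hB b).pt := isUnit_of_swap_notMem (hB := hB) (hat_notMem hb)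
    rw [pt_swap_muMap h hc, pt_swap_muMap h hbu, pt_muMap hs', pt_swap_muMap h hau,
      B.mu_congr hc (isUnit_swap_sum h ha' hb' hs) (pt_hat_add ha hb), mu_swap_sum h ha' hb' hs,
      B.mu_congr hau ha' (pt_hat ha), B.mu_congr hbu hb' (pt_hat hb),
      B.mu_congr hs hs' (V.pt_add a b).symm, mul_smul, mul_smul]
  comp x y z hx hy := by
    apply V.ext
    have hx' := isUnit_of_notMem hx
    have hy' : B.IsUnit y.pt := isUnit_of_swap_notMem (hB := hB) hy
    have hxy : B.IsUnit (B.muMap hB x y).pt := by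
      rw [pt_muMap hx']
      exact B.isUnit_mu_smul hx' hy'
    have hn : B.IsUnit (-x).pt := isUnit_of_notMem (UnitComplement.neg_notMem hx)
    rw [pt_muMap hxy, B.mu_congr hxy (B.isUnit_mu_smul hx' hy') (pt_muMap hx' y),
      mu_mu_smul h hx' hy', pt_muMap hx', pt_swap_muMap h hy', pt_muMap hn,
      B.mu_congr hn (B.isUnit_neg hx') (V.pt_neg x), mu_neg h hx', mul_smul, mul_smul]
  add_mem x n y hx hn := by
    have hx' := isUnit_of_notMem hx
    have hs' := isUnit_of_notMem (UnitComplement.add_mem_notMem hx hn)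
    rw [rel_of_sub_mem, pt_muMap hx', pt_muMap hs']
    apply mu_smul_rel h
    rw [← rel_of_sub_mem, add_sub_cancel_left]
    exact hn

/-- The μ-maps of the opposite basis are the inverses, that is, the μ-maps of `-y`. So (J4) is used
at `-y` and `-w`, where the biadditive map has the same value. -/
theorem ExtendsMuMinus.swap (h : B.NegSwap)
    {T : B.VMinus hB →ₗ[ℤ] B.VMinus hB →ₗ[ℤ] B.VPlus hB →ₗ[ℤ] B.VMinus hB}
    (hT : B.ExtendsMuMinus hB T) : B.swap.ExtendsMuPlus hB.swap T := by
  intro y w hy hw hyw x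
  have key : ∀ (y n : B.swap.V hB.swap) (hy : B.IsUnit y.pt) (hn : B.IsUnit n.pt) (_ : n = -y),
      (show B.VMinus hB from B.muMinus n.pt hn x) = B.swap.muPlus y.pt hy.swap x := by
    intro y n hy hn e
    apply Subtype.ext
    change B.mu n.pt hn • x.1 = B.swap.mu y.pt hy.swap • x.1
    have e1 : n.pt = (B.alphaUnit y.pt hy)⁻¹ • B.zero := by
      rw [e, V.pt_neg]
      exact h y.pt hy
    rw [swap_mu h hy, B.mu_congr hn (B.isUnit_neg hy) e1, mu_neg h hy]
  have hneg : ∀ (y : B.swap.V hB.swap), B.IsUnit y.pt → B.IsUnit (-y).pt := fun y hy =>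
    isUnit_of_swap_notMem (hB := hB) (UnitComplement.neg_notMem hy.2)
  have hs : B.IsUnit (-y + -w).pt := by
    rw [← neg_add]
    exact hneg _ hyw.swap
  have e := hT (-y) (-w) (hneg y hy.swap) (hneg w hw.swap) hs x
  simp only [map_neg, LinearMap.neg_apply, neg_neg] at e
  refine e.trans ?_
  exact congrArg₂ (fun a b : B.VMinus hB => a - b)
    (congrArg₂ (fun a b : B.VMinus hB => a - b) (key (y + w) _ hyw.swap hs (neg_add y w).symm)
      (key y _ hy.swap (hneg y hy.swap) rfl)) (key w _ hw.swap (hneg w hw.swap) rfl)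

end Basis

end LocalMoufangSet

theorem uniquelyDivisible_of_bijective {n : ℕ} {A : Type u} [AddCommGroup A]
    (h : Function.Bijective fun a : A => n • a) : UniquelyDivisible n A :=
  fun a => h.existsUnique a

theorem mainTheorem9 {X : Type u} (M : LocalMoufangSet X) (B : M.Basis)
    (e : X) (he : B.IsUnit e)
    (hJ1 : B.IsSpecial e he)
    (hJ2 : B.IsAbelian)
    (hJ3 : ∀ (x : X) (hx : B.IsUnit x),
      B.IsUnit (B.times ⟨x, hx.2⟩ 2).1 ∧ B.IsUnit (B.times ⟨x, hx.2⟩ 3).1)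
    (muP : B.VPlus hJ2 →ₗ[ℤ] B.VPlus hJ2 →ₗ[ℤ] B.VMinus hJ2 →ₗ[ℤ] B.VPlus hJ2)
    (muM : B.VMinus hJ2 →ₗ[ℤ] B.VMinus hJ2 →ₗ[ℤ] B.VPlus hJ2 →ₗ[ℤ] B.VMinus hJ2)
    (hJ4P : B.ExtendsMuPlus hJ2 muP) (hJ4M : B.ExtendsMuMinus hJ2 muM) :
    UniquelyDivisible 2 (B.VPlus hJ2) ∧ UniquelyDivisible 3 (B.VPlus hJ2) ∧
    UniquelyDivisible 2 (B.VMinus hJ2) ∧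
    ∃ (Qp : QuadraticMap ℤ (B.VPlus hJ2) (B.VMinus hJ2 →ₗ[ℤ] B.VPlus hJ2))
      (Qm : QuadraticMap ℤ (B.VMinus hJ2) (B.VPlus hJ2 →ₗ[ℤ] B.VMinus hJ2)),
      (∀ x y, 2 • Qp x y = muP x x y) ∧ (∀ y x, 2 • Qm y x = muM y y x) ∧
      JordanPair.IsJordanPair.{t} Qp Qm ∧
      JordanPair.IsLocal Qp Qm ∧
      (∀ x : B.VPlus hJ2, ¬ JordanPair.IsInvertible Qp x ↔ M.rel x.pt B.zero) ∧
      (∀ y : B.VMinus hJ2, ¬ JordanPair.IsInvertible Qm y ↔ M.rel y.pt B.inf) ∧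
      JordanPair.radPlus Qp Qm = {x | M.rel x.pt B.zero} ∧
      JordanPair.radMinus Qp Qm = {y | M.rel y.pt B.inf} := by
  have hn := hJ1.negSwap
  have huc := LocalMoufangSet.Basis.unitComplement (hB := hJ2) hJ3
  have h := LocalMoufangSet.Basis.muUnits hn huc muP hJ4P
  -- The other sign is the same construction for the basis (∞, 0).
  have h' : MuUnits (B.swap.nonunits hJ2.swap) (B.nonunits hJ2) (B.swap.hat hJ2.swap)
      (B.hat hJ2) (B.swap.muMap hJ2.swap) (B.muMap hJ2) muM :=
    LocalMoufangSet.Basis.muUnits hn.swap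
      (LocalMoufangSet.Basis.unitComplement_swap huc) muM (hJ4M.swap hn)
  have j := h.jordanUnits h'
  have j' := h'.jordanUnits h
  refine ⟨uniquelyDivisible_of_bijective (h.two_bijective h'),
    uniquelyDivisible_of_bijective (h.three_bijective h'),
    uniquelyDivisible_of_bijective (h'.two_bijective h),
    LinearMap.BilinMap.toQuadraticMap (MuUnits.halfPolar muP (h.two_bijective h')),
    LinearMap.BilinMap.toQuadraticMap (MuUnits.halfPolar muM (h'.two_bijective h)),
    fun x y => MuUnits.two_halfPolar _ _ x x y, fun y x => MuUnits.two_halfPolar _ _ y y x,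
    (j.fiveLinear j').isJordanPair (j'.fiveLinear j) (h.three_bijective h')
      (h'.three_bijective h), j.isLocal j', j.isInvertible_iff j', j'.isInvertible_iff j,
    j.radPlus_eq j', j.radMinus_eq j'⟩
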